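/- A pentagon is a simple closed polygon in the Euclidean plane with five vertices, together with the closed region it bounds; it need not be convex, and interior angles equal to $\pi$ are allowed. A unit-area Cairo (respectively Prismatic) pentagon is a unit-area pentagon circumscribed about a circle with three angles $2\pi/3$ and two nonadjacent (respectively adjacent) right angles; both have perimeter $2\sqrt{2+\sqrt3}$. A unit-area pentagon is called efficient if its perimeter is at most that of a unit-area Cairo pentagon. A non-convex pentagon is of Type 1 if exactly one of its interior angles is larger than $\pi$, and of Type 2 if exactly two of its interior angles are larger than $\pi$, these two having average less than $3\pi/2$. Let $T$ be an edge-to-edge tiling of the plane by unit-area pentagons: the tiles cover the plane, have pairwise disjoint interiors, and any two of them meet only along entire common edges or at common vertices. The perimeter ratio of $T$ is $$ \rho=\limsup_{R\to\infty}\frac{P(R)}{\pi R^2}\in[0,\infty], $$ where $P(R)$ is the total length of the part of the union of all tile boundaries that lies in the disk of radius $R$ about the origin (an edge shared by two tiles is counted once). For $R>0$ let $C_1(R)$, $N_1(R)$ and $N_2(R)$ be the fractions, among the tiles completely inside the disk of radius $R$ about the origin, of the efficient, the Type 1 non-convex and the Type 2 non-convex tiles, respectively (taken to be $0$ if no tile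 lies inside the disk). If $\rho$ is at most half the perimeter of a unit-area Prismatic pentagon, i.e. $\rho\le\sqrt{2+\sqrt3}$, then $$ \liminf_{R\to\infty}\bigl(C_1(R)-2.6\,N_1(R)-13.4\,N_2(R)\bigr)\ \ge\ 0 . $$ -/

import Mathlib

open MeasureTheory Filter Set Topology
open scoped ENNReal Real

noncomputable section

namespace PentagonTilings

/-! The Euclidean plane is `ℂ`: the distance is the Euclidean one, `volume` is area, and the
one-dimensional Hausdorff measure `μH[1]` is length. -/

/-- The perimeter of a polygon: the sum of the lengths of its edges. -/
def perimeter {n : ℕ} (P : Polygon ℂ n) : ℝ :=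
  ∑ i, dist (P i) (P (finRotate n i))

/-- A (not necessarily convex) simple pentagon in the plane, together with the closed region that it
bounds. Distinct edges meet at most in common vertices. The region is the compact regular closed set
whose frontier is the polygon; by the Jordan curve theorem it is the union of the polygon and of the
bounded component of its complement. Angles equal to `π` are allowed. -/
structure Pentagon where
  /-- The closed polygon with its five vertices, in cyclic order. -/
  poly : Polygon ℂ 5
  /-- The closed region bounded by the polygon. -/
  region : Set ℂ
  vertices_injective : Function.Injective poly.vertices
  simple : ∀ i j, i ≠ j → poly.edgeSet ℝ i ∩ poly.edgeSet ℝ j ⊆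
    {poly i, poly (finRotate 5 i)} ∩ {poly j, poly (finRotate 5 j)}
  isCompact_region : IsCompact region
  closure_interior_region : closure (interior region) = region
  frontier_region : frontier region = poly.boundary ℝ

/-- The interior angle at the `k`-th vertex: the angular measure of the set of directions that point
from the vertex into the region. -/
def Pentagon.interiorAngle (P : Pentagon) (k : Fin 5) : ℝ :=
  (volume {φ : ℝ | φ ∈ Ioc (-π) π ∧
    ∀ᶠ r : ℝ in 𝓝[>] 0, P.poly k + r * Complex.exp (φ * Complex.I) ∈ P.region}).toReal

/-- The inradius of the unit-area Cairo and Prismatic pentagons. -/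
def inradius : ℝ := 1 / √(2 + √3)

/-- The unit-area Prismatic pentagon: it is circumscribed about the circle of radius `inradius` about
the origin and has angles `π/2, π/2, 2π/3, 2π/3, 2π/3`, in this cyclic order. -/
def prismatic : Polygon ℂ 5 where
  vertices := ![⟨-inradius, -inradius⟩, ⟨inradius, -inradius⟩, ⟨inradius, inradius / √3⟩,
    ⟨0, 2 * inradius / √3⟩, ⟨-inradius, inradius / √3⟩]

/-- The unit-area Cairo pentagon: it is circumscribed about the circle of radius `inradius` about
the origin and has angles `2π/3, π/2, 2π/3, 2π/3, π/2`, in this cyclic order. -/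
def cairo : Polygon ℂ 5 where
  vertices := ![⟨0, -(2 * inradius / √3)⟩,
    ⟨inradius * (√3 + 1) / 2, -(inradius * (√3 - 1) / 2)⟩, ⟨inradius / √3, inradius⟩,
    ⟨-(inradius / √3), inradius⟩, ⟨-(inradius * (√3 + 1) / 2), -(inradius * (√3 - 1) / 2)⟩]

/-- A pentagon (of unit area) is efficient if its perimeter is at most that of a Cairo pentagon. -/
def Pentagon.IsEfficient (P : Pentagon) : Prop :=
  volume P.region = 1 ∧ perimeter P.poly ≤ perimeter cairo

/-- Type 1: a non-convex pentagon with exactly one interior angle larger than `π`. -/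
def Pentagon.IsType1 (P : Pentagon) : Prop :=
  ¬ Convex ℝ P.region ∧ ∃ j, {k | π < P.interiorAngle k} = {j}

/-- Type 2: a non-convex pentagon with exactly two interior angles larger than `π`, whose average is
less than `3π/2`. -/
def Pentagon.IsType2 (P : Pentagon) : Prop :=
  ¬ Convex ℝ P.region ∧ ∃ i j, i ≠ j ∧ {k | π < P.interiorAngle k} = {i, j} ∧
    (P.interiorAngle i + P.interiorAngle j) / 2 < 3 * π / 2

/-- An edge-to-edge tiling of the plane by unit-area pentagons. -/
structure PentagonTiling (ι : Type*) where
  /-- The tiles. -/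
  tile : ι → Pentagon
  unit_area : ∀ i, volume (tile i).region = 1
  cover : ⋃ i, (tile i).region = univ
  disjoint_interiors : ∀ i j, i ≠ j →
    Disjoint (interior (tile i).region) (interior (tile j).region)
  /-- Two tiles meet only along entire common edges or at common vertices. -/
  edge_to_edge : ∀ i j, i ≠ j → ∀ p ∈ (tile i).region ∩ (tile j).region,
    (∃ k l, (tile i).poly k = p ∧ (tile j).poly l = p) ∨
    (∃ k l, (tile i).poly.edgeSet ℝ k = (tile j).poly.edgeSet ℝ l ∧
      p ∈ (tile i).poly.edgeSet ℝ k)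

variable {ι : Type*}

/-- The union of the boundaries of all tiles. -/
def PentagonTiling.skeleton (T : PentagonTiling ι) : Set ℂ :=
  ⋃ i, (T.tile i).poly.boundary ℝ

/-- The perimeter ratio: the limit superior, as `R → ∞`, of the perimeter of the tiling inside the
disk of radius `R` about the origin divided by `π R ^ 2`, as an extended nonnegative number. (An edge
shared by two tiles is counted once.) -/
def PentagonTiling.perimeterRatio (T : PentagonTiling ι) : ℝ≥0∞ :=
  limsup (fun R : ℝ => μH[1] (T.skeleton ∩ Metric.closedBall 0 R) / ENNReal.ofReal (π * R ^ 2))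
    atTop

/-- The tiles completely inside the disk of radius `R` about the origin. -/
def PentagonTiling.inside (T : PentagonTiling ι) (R : ℝ) : Set ι :=
  {i | (T.tile i).region ⊆ Metric.closedBall 0 R}

/-- The fraction of the tiles completely inside the disk of radius `R` about the origin that have the
property `S`. It lies in `[0, 1]`. -/
def PentagonTiling.fraction (T : PentagonTiling ι) (S : Pentagon → Prop) (R : ℝ) : ℝ :=
  ({i ∈ T.inside R | S (T.tile i)}.ncard : ℝ) / ((T.inside R).ncard : ℝ)

section Perimeters

theorem inradius_pos : 0 < inradius := by
  unfold inradius
  positivity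

theorem dist_eq_of_sq {a b c d l : ℝ} (hl : 0 ≤ l) (h : (a - c) ^ 2 + (b - d) ^ 2 = l ^ 2) :
    dist (⟨a, b⟩ : ℂ) ⟨c, d⟩ = l := by
  rw [Complex.dist_eq_re_im]
  simp only [h]
  exact Real.sqrt_sq hl

theorem inradius_mul : inradius * (2 + √3) = √(2 + √3) := by
  unfold inradius
  rw [one_div, inv_mul_eq_div]
  exact Real.div_sqrt

theorem perimeter_prismatic : perimeter prismatic = 2 * √(2 + √3) := by
  have h3 : √3 ^ 2 = 3 := Real.sq_sqrt (by norm_num)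
  have h0 : (0 : ℝ) < √3 := by positivity
  have hr := inradius_pos
  have e0 : dist (⟨-inradius, -inradius⟩ : ℂ) ⟨inradius, -inradius⟩ = 2 * inradius :=
    dist_eq_of_sq (by positivity) (by ring)
  have e1 : dist (⟨inradius, -inradius⟩ : ℂ) ⟨inradius, inradius / √3⟩
      = inradius * (1 + 1 / √3) := dist_eq_of_sq (by positivity) (by ring)
  have e2 : dist (⟨inradius, inradius / √3⟩ : ℂ) ⟨0, 2 * inradius / √3⟩
      = inradius * (2 / √3) := dist_eq_of_sq (by positivity) (by field_simp; rw [h3]; ring)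
  have e3 : dist (⟨0, 2 * inradius / √3⟩ : ℂ) ⟨-inradius, inradius / √3⟩
      = inradius * (2 / √3) := dist_eq_of_sq (by positivity) (by field_simp; rw [h3]; ring)
  have e4 : dist (⟨-inradius, inradius / √3⟩ : ℂ) ⟨-inradius, -inradius⟩
      = inradius * (1 + 1 / √3) := dist_eq_of_sq (by positivity) (by ring)
  simp only [perimeter, Fin.sum_univ_five, finRotate_apply]
  change dist (⟨-inradius, -inradius⟩ : ℂ) ⟨inradius, -inradius⟩
    + dist (⟨inradius, -inradius⟩ : ℂ) ⟨inradius, inradius / √3⟩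
    + dist (⟨inradius, inradius / √3⟩ : ℂ) ⟨0, 2 * inradius / √3⟩
    + dist (⟨0, 2 * inradius / √3⟩ : ℂ) ⟨-inradius, inradius / √3⟩
    + dist (⟨-inradius, inradius / √3⟩ : ℂ) ⟨-inradius, -inradius⟩ = _
  rw [e0, e1, e2, e3, e4, ← inradius_mul]
  field_simp
  linarith

theorem perimeter_cairo : perimeter cairo = 2 * √(2 + √3) := by
  have h3 : √3 ^ 2 = 3 := Real.sq_sqrt (by norm_num)
  have h0 : (0 : ℝ) < √3 := by positivity
  have h4 : 1 / √3 = √3 / 3 := by field_simp; linarith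
  have hr := inradius_pos
  have d0 : ∀ x : ℝ, x / √3 = x * (√3 / 3) := fun x => by rw [← h4]; ring
  have e0 : dist (⟨0, -(2 * inradius / √3)⟩ : ℂ)
      ⟨inradius * (√3 + 1) / 2, -(inradius * (√3 - 1) / 2)⟩ = inradius * (1 + √3 / 3) :=
    dist_eq_of_sq (by positivity)
      (by rw [d0]; linear_combination (inradius ^ 2 * (1 / 6)) * h3)
  have e1 : dist (⟨inradius * (√3 + 1) / 2, -(inradius * (√3 - 1) / 2)⟩ : ℂ)
      ⟨inradius / √3, inradius⟩ = inradius * (1 + √3 / 3) :=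
    dist_eq_of_sq (by positivity)
      (by rw [d0]; linear_combination (inradius ^ 2 * (1 / 6)) * h3)
  have e2 : dist (⟨inradius / √3, inradius⟩ : ℂ) ⟨-(inradius / √3), inradius⟩
      = 2 * inradius * (√3 / 3) :=
    dist_eq_of_sq (by positivity) (by rw [d0]; ring)
  have e3 : dist (⟨-(inradius / √3), inradius⟩ : ℂ)
      ⟨-(inradius * (√3 + 1) / 2), -(inradius * (√3 - 1) / 2)⟩ = inradius * (1 + √3 / 3) :=
    dist_eq_of_sq (by positivity)
      (by rw [d0]; linear_combination (inradius ^ 2 * (1 / 6)) * h3)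
  have e4 : dist (⟨-(inradius * (√3 + 1) / 2), -(inradius * (√3 - 1) / 2)⟩ : ℂ)
      ⟨0, -(2 * inradius / √3)⟩ = inradius * (1 + √3 / 3) :=
    dist_eq_of_sq (by positivity)
      (by rw [d0]; linear_combination (inradius ^ 2 * (1 / 6)) * h3)
  simp only [perimeter, Fin.sum_univ_five, finRotate_apply]
  change dist (⟨0, -(2 * inradius / √3)⟩ : ℂ)
      ⟨inradius * (√3 + 1) / 2, -(inradius * (√3 - 1) / 2)⟩
    + dist (⟨inradius * (√3 + 1) / 2, -(inradius * (√3 - 1) / 2)⟩ : ℂ)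
      ⟨inradius / √3, inradius⟩
    + dist (⟨inradius / √3, inradius⟩ : ℂ) ⟨-(inradius / √3), inradius⟩
    + dist (⟨-(inradius / √3), inradius⟩ : ℂ)
      ⟨-(inradius * (√3 + 1) / 2), -(inradius * (√3 - 1) / 2)⟩
    + dist (⟨-(inradius * (√3 + 1) / 2), -(inradius * (√3 - 1) / 2)⟩ : ℂ)
      ⟨0, -(2 * inradius / √3)⟩ = _
  rw [e0, e1, e2, e3, e4, ← inradius_mul]
  ring

end Perimeters

end PentagonTilings

end

/-! The proof is an excess count against c, the common perimeter of the Cairo and Prismatic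
pentagons. Replacing a unit-area pentagon by the convex hull of its vertices loses no area, so
isoperimetric inequalities for hulls bound its perimeter from below. In general the perimeter is at
least about that of the regular pentagon (`Pentagon.le_perimeter`). A reflex vertex lies in the hull
of the other vertices (`Pentagon.mem_convexHull_of_pi_lt`), so one reflex angle leaves at most a
quadrilateral and forces perimeter 4, that of a square, while two leave at most a triangle and force
about √(12√3), the equilateral value. Hence an efficient tile saves at most δ = 0.051885 compared
with c, while Type 1 and Type 2 tiles cost at least 2.6 δ and 13.4 δ more than c
(`Pentagon.le_perimeter_sub`).

The pentagonal inequality `shoelace_le` combines a Fourier estimate of signed area by the sum of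
squared edges (`wirtinger`) with an extremal argument that makes all edges equal.

Summing over the N tiles inside the disk of radius R, δ(2.6 n₁ + 13.4 n₂ − n₀) is at most their
total perimeter minus cN, where n₁, n₂, n₀ count Type 1, Type 2 and efficient tiles. Boundaries
cover the skeleton at most twice, which bounds the total perimeter by about cπR². Tiles may be
arbitrarily long, so the circle needs care: each of the D tiles that leave the disk but reach depth
8 has boundary length at least 8 > c in the disk, and N + D ≥ π(R − 8)². The excess is therefore
o(R²), while N is at least of order R². -/

noncomputable section

namespace PentagonTilings

/-! ### Signed areas and the discrete Wirtinger inequality -/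

/-- Twice the signed area of the triangle `a b c`. -/
def cross (a b c : ℂ) : ℝ := (b.re - a.re) * (c.im - a.im) - (b.im - a.im) * (c.re - a.re)

theorem dist_sq_eq (a b : ℂ) : dist a b ^ 2 = (b.re - a.re) ^ 2 + (b.im - a.im) ^ 2 := by
  rw [Complex.dist_eq_re_im, Real.sq_sqrt (by positivity)]
  ring

/-- With ω = C₁ + iS₁, the hypotheses say |ω| = 1, ω² = C₂ + iS₂ and ω³ = ω⁻², so ω is a fifth root
of unity. The form is the squared modulus of the Fourier coefficient ∑ ω⁻ʲ zⱼ. -/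
theorem dft_form_nonneg {C₁ S₁ C₂ S₂ : ℝ} (h1 : C₁ ^ 2 + S₁ ^ 2 = 1) (h2 : C₂ = C₁ ^ 2 - S₁ ^ 2)
    (h3 : S₂ = 2 * S₁ * C₁) (h4 : C₁ * C₂ - S₁ * S₂ = C₂) (h5 : S₁ * C₂ + C₁ * S₂ = -S₂)
    (x₀ x₁ x₂ x₃ x₄ y₀ y₁ y₂ y₃ y₄ : ℝ) :
    0 ≤ (x₀ ^ 2 + x₁ ^ 2 + x₂ ^ 2 + x₃ ^ 2 + x₄ ^ 2 + y₀ ^ 2 + y₁ ^ 2 + y₂ ^ 2 + y₃ ^ 2 + y₄ ^ 2)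
      + 2 * C₁ * ((x₀ * x₁ + y₀ * y₁) + (x₁ * x₂ + y₁ * y₂) + (x₂ * x₃ + y₂ * y₃)
        + (x₃ * x₄ + y₃ * y₄) + (x₄ * x₀ + y₄ * y₀))
      + 2 * C₂ * ((x₀ * x₂ + y₀ * y₂) + (x₁ * x₃ + y₁ * y₃) + (x₂ * x₄ + y₂ * y₄)
        + (x₃ * x₀ + y₃ * y₀) + (x₄ * x₁ + y₄ * y₁))
      + 2 * S₁ * ((x₀ * y₁ - y₀ * x₁) + (x₁ * y₂ - y₁ * x₂) + (x₂ * y₃ - y₂ * x₃)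
        + (x₃ * y₄ - y₃ * x₄) + (x₄ * y₀ - y₄ * x₀))
      + 2 * S₂ * ((x₀ * y₂ - y₀ * x₂) + (x₁ * y₃ - y₁ * x₃) + (x₂ * y₄ - y₂ * x₄)
        + (x₃ * y₀ - y₃ * x₀) + (x₄ * y₁ - y₄ * x₁)) := by
  have k1 : C₂ ^ 2 + S₂ ^ 2 = 1 := by
    rw [h2, h3]; linear_combination (C₁ ^ 2 + S₁ ^ 2 + 1) * h1
  have k2 : C₁ * C₂ + S₁ * S₂ = C₁ := by
    rw [h2, h3]; linear_combination C₁ * h1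
  have k3 : C₁ * S₂ - S₁ * C₂ = S₁ := by
    rw [h2, h3]; linear_combination S₁ * h1
  have k4 : C₂ ^ 2 - S₂ ^ 2 = C₁ := by
    linear_combination k2 + C₂ * h2 - S₂ * h3 + C₁ * h4 - S₁ * h5
  have k5 : 2 * S₂ * C₂ = -S₁ := by
    linear_combination -k3 + S₂ * h2 + C₂ * h3 + S₁ * h4 + C₁ * h5
  have key : 0 ≤ (x₀ + C₁ * x₁ + S₁ * y₁ + C₂ * x₂ + S₂ * y₂ + C₂ * x₃ - S₂ * y₃
      + C₁ * x₄ - S₁ * y₄) ^ 2 + (y₀ + C₁ * y₁ - S₁ * x₁ + C₂ * y₂ - S₂ * x₂ + C₂ * y₃ + S₂ * x₃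
      + C₁ * y₄ + S₁ * x₄) ^ 2 := by positivity
  refine key.trans_eq ?_
  linear_combination (x₁ ^ 2 + y₁ ^ 2 + x₄ ^ 2 + y₄ ^ 2) * h1
    + (x₂ ^ 2 + y₂ ^ 2 + x₃ ^ 2 + y₃ ^ 2) * k1
    + 2 * (x₁ * x₂ + y₁ * y₂) * k2 + 2 * (x₁ * y₂ - y₁ * x₂) * k3
    + 2 * (x₁ * x₃ + y₁ * y₃) * h4 - 2 * (x₁ * y₃ - y₁ * x₃) * h5
    - 2 * (x₁ * x₄ + y₁ * y₄) * h2 + 2 * (x₁ * y₄ - y₁ * x₄) * h3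
    + 2 * (x₂ * x₃ + y₂ * y₃) * k4 - 2 * (x₂ * y₃ - y₂ * x₃) * k5
    + 2 * (x₂ * x₄ + y₂ * y₄) * h4 - 2 * (x₂ * y₄ - y₂ * x₄) * h5
    + 2 * (x₃ * x₄ + y₃ * y₄) * k2 + 2 * (x₃ * y₄ - y₃ * x₄) * k3

/-- The sine of `2π/5`. -/
def sin72 : ℝ := √((5 + √5) / 8)

/-- The tangent of `π/5`. -/
def tan36 : ℝ := sin72 * (3 - √5)

theorem sqrt_five_sq : √5 ^ 2 = 5 := Real.sq_sqrt (by norm_num)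

theorem sin72_sq : sin72 ^ 2 = (5 + √5) / 8 := Real.sq_sqrt (by positivity)

theorem lt_tan36 : 0.7265 < tan36 := by
  have h5 := sqrt_five_sq
  have hs := sin72_sq
  have a1 : 2.236067 < √5 := Real.lt_sqrt_of_sq_lt (by norm_num)
  have a2 : √5 < 2.236068 := (Real.sqrt_lt' (by norm_num)).2 (by norm_num)
  have b1 : 0.95105 < sin72 := Real.lt_sqrt_of_sq_lt (by norm_num; linarith)
  have b2 : sin72 < 1 := (Real.sqrt_lt' (by norm_num)).2 (by linarith)
  unfold tan36
  nlinarith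

/-- Both sides are diagonal in the discrete Fourier basis. Their difference vanishes at frequency 0
(translations) and at frequency 1 (regular pentagons), and is positive at frequencies 2, 3, 4. -/
theorem wirtinger_real (x₀ x₁ x₂ x₃ x₄ y₀ y₁ y₂ y₃ y₄ : ℝ) :
    2 * tan36 * ((x₀ * y₁ - y₀ * x₁) + (x₁ * y₂ - y₁ * x₂) + (x₂ * y₃ - y₂ * x₃)
        + (x₃ * y₄ - y₃ * x₄) + (x₄ * y₀ - y₄ * x₀)) ≤
    ((x₁ - x₀) ^ 2 + (y₁ - y₀) ^ 2) + ((x₂ - x₁) ^ 2 + (y₂ - y₁) ^ 2)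
      + ((x₃ - x₂) ^ 2 + (y₃ - y₂) ^ 2) + ((x₄ - x₃) ^ 2 + (y₄ - y₃) ^ 2)
      + ((x₀ - x₄) ^ 2 + (y₀ - y₄) ^ 2) := by
  have h5 := sqrt_five_sq
  have hs := sin72_sq
  set r := √5 with hr
  set s := sin72 with hsd
  have hr0 : 0 ≤ r := Real.sqrt_nonneg _
  have n2 := dft_form_nonneg (C₁ := (-r - 1) / 4) (S₁ := s * (r - 1) / 2) (C₂ := (r - 1) / 4)
    (S₂ := -s)
    (by linear_combination ((r - 1) ^ 2 / 4) * hs + (r / 32 + 5 / 32) * h5)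
    (by linear_combination ((r - 1) ^ 2 / 4) * hs + (r / 32 + 1 / 32) * h5)
    (by linear_combination (s / 4) * h5)
    (by linear_combination ((r - 1) / 2) * hs)
    (by linear_combination (s / 8) * h5)
    x₀ x₁ x₂ x₃ x₄ y₀ y₁ y₂ y₃ y₄
  have n3 := dft_form_nonneg (C₁ := (-r - 1) / 4) (S₁ := -(s * (r - 1) / 2)) (C₂ := (r - 1) / 4)
    (S₂ := s)
    (by linear_combination ((r - 1) ^ 2 / 4) * hs + (r / 32 + 5 / 32) * h5)
    (by linear_combination ((r - 1) ^ 2 / 4) * hs + (r / 32 + 1 / 32) * h5)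
    (by linear_combination (-s / 4) * h5)
    (by linear_combination ((r - 1) / 2) * hs)
    (by linear_combination (-s / 8) * h5)
    x₀ x₁ x₂ x₃ x₄ y₀ y₁ y₂ y₃ y₄
  have n4 := dft_form_nonneg (C₁ := (r - 1) / 4) (S₁ := -s) (C₂ := (-r - 1) / 4)
    (S₂ := -(s * (r - 1) / 2))
    (by linear_combination hs + (1 / 16) * h5)
    (by linear_combination hs - (1 / 16) * h5)
    (by ring)
    (by linear_combination (-(r - 1) / 2) * hs - (1 / 8) * h5)
    (by linear_combination (-s / 8) * h5)
    x₀ x₁ x₂ x₃ x₄ y₀ y₁ y₂ y₃ y₄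
  have hr2 : r ≤ 5 := by nlinarith
  -- The forms `n2`, `n3`, `n4` belong to θ = 2πk/5 with k = 2, 3, 4. The weights are (2 − 2 cos θ −
  -- 2 tan(π/5) sin θ)/5.
  have m2 := mul_nonneg (show 0 ≤ 1 - r / 5 by linarith) n2
  have m3 := mul_nonneg (show 0 ≤ 2 * r / 5 by linarith) n3
  have m4 := mul_nonneg (show 0 ≤ 1 - r / 5 by linarith) n4
  have ht : tan36 = s * (3 - r) := rfl
  rw [ht]
  linear_combination m2 + m3 + m4 + (-1 / 5 * ((x₀ * x₁ + y₀ * y₁) + (x₁ * x₂ + y₁ * y₂) + (x₂ * x₃ + y₂ * y₃)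
        + (x₃ * x₄ + y₃ * y₄) + (x₄ * x₀ + y₄ * y₀))
      + 1 / 5 * ((x₀ * x₂ + y₀ * y₂) + (x₁ * x₃ + y₁ * y₃) + (x₂ * x₄ + y₂ * y₄)
        + (x₃ * x₀ + y₃ * y₀) + (x₄ * x₁ + y₄ * y₁))
      - 3 * s / 5 * ((x₀ * y₁ - y₀ * x₁) + (x₁ * y₂ - y₁ * x₂) + (x₂ * y₃ - y₂ * x₃)
        + (x₃ * y₄ - y₃ * x₄) + (x₄ * y₀ - y₄ * x₀))
      + s / 5 * ((x₀ * y₂ - y₀ * x₂) + (x₁ * y₃ - y₁ * x₃) + (x₂ * y₄ - y₂ * x₄)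
        + (x₃ * y₀ - y₃ * x₀) + (x₄ * y₁ - y₄ * x₁))) * h5

/-! ### The isoperimetric inequality for closed five-point paths -/

theorem cross_sq (u v w : ℂ) : 4 * cross u v w ^ 2 =
    4 * dist u v ^ 2 * dist u w ^ 2 - (dist u v ^ 2 + dist u w ^ 2 - dist v w ^ 2) ^ 2 := by
  rw [dist_sq_eq, dist_sq_eq, dist_sq_eq, cross]
  ring

/-- Moving the apex of a triangle so that it becomes isosceles with the same perimeter does not
decrease the signed area. -/
theorem exists_isosceles (u v w : ℂ) : ∃ v', dist u v' = (dist u v + dist v w) / 2 ∧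
    dist v' w = (dist u v + dist v w) / 2 ∧ cross u v w ≤ cross u v' w := by
  set p := dist u v
  set q := dist v w
  have hp : 0 ≤ p := dist_nonneg
  have hq : 0 ≤ q := dist_nonneg
  rcases eq_or_ne u w with rfl | huw
  · refine ⟨u + ((p + q) / 2 : ℝ), ?_, ?_, ?_⟩
    · rw [dist_self_add_right, Complex.norm_real, Real.norm_of_nonneg (by positivity)]
    · rw [dist_self_add_left, Complex.norm_real, Real.norm_of_nonneg (by positivity)]
    · simp [cross]
  set d := dist u w with hd
  have hd0 : 0 < d := dist_pos.2 huw
  have htri : d ≤ p + q := dist_triangle _ _ _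
  have e1 : p - q ≤ d := by
    have := dist_triangle u w v
    rw [dist_comm w v] at this
    linarith
  have e2 : q - p ≤ d := by
    have := dist_triangle v u w
    rw [dist_comm v u] at this
    linarith
  -- The height of the isosceles triangle over the base u w. The new apex is always put on the
  -- positive side, whatever the orientation of the old triangle.
  set h := √(((p + q) / 2) ^ 2 - (d / 2) ^ 2) with hh
  have hnn : 0 ≤ ((p + q) / 2) ^ 2 - (d / 2) ^ 2 := by nlinarith
  have hh2 : h ^ 2 = ((p + q) / 2) ^ 2 - (d / 2) ^ 2 := Real.sq_sqrt hnn
  have hh0 : 0 ≤ h := Real.sqrt_nonneg _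
  have hd2 : d ^ 2 = (w.re - u.re) ^ 2 + (w.im - u.im) ^ 2 := dist_sq_eq u w
  have hk : (h / d) ^ 2 * d ^ 2 = h ^ 2 := by field_simp
  set k := h / d with hkd
  have hkd' : k * d ^ 2 = h * d := by rw [hkd]; field_simp
  have hcross := cross_sq u v w
  set v' : ℂ := ⟨(u.re + w.re) / 2 + k * (w.im - u.im), (u.im + w.im) / 2 - k * (w.re - u.re)⟩
  have hv : cross u v' w = h * d := by
    rw [← hkd', hd2]
    simp only [cross, v']
    ring
  refine ⟨v', ?_, ?_, ?_⟩
  · rw [← sq_eq_sq₀ dist_nonneg (by positivity), dist_sq_eq]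
    simp only [v']
    linear_combination (-(1 : ℝ) / 4) * hd2 + hk - k ^ 2 * hd2 + hh2
  · rw [← sq_eq_sq₀ dist_nonneg (by positivity), dist_sq_eq]
    simp only [v']
    linear_combination (-(1 : ℝ) / 4) * hd2 + hk - k ^ 2 * hd2 + hh2
  · rw [hv]
    apply le_of_sq_le_sq _ (by positivity)
    -- By Heron, 4 (`cross u v w`)² = ((p + q)² − d²)(d² − (p − q)²), and dropping (p − q)² gives
    -- the isosceles value.
    have : 4 * (h * d) ^ 2 = d ^ 2 * ((p + q) ^ 2 - d ^ 2) := by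
      rw [mul_pow, hh2]; ring
    have h3 : 0 ≤ ((p + q) ^ 2 - d ^ 2) * (p - q) ^ 2 := by
      apply mul_nonneg _ (sq_nonneg _)
      nlinarith
    nlinarith

/-- The signed area of a closed path through five points. -/
def shoelace (z : Fin 5 → ℂ) : ℝ :=
  (∑ i, ((z i).re * (z (i + 1)).im - (z i).im * (z (i + 1)).re)) / 2

/-- The length of a closed path through five points. -/
def pathLength (z : Fin 5 → ℂ) : ℝ := ∑ i, dist (z i) (z (i + 1))

/-- The sum of the squared edge lengths of a closed path through five points. -/
def sqLength (z : Fin 5 → ℂ) : ℝ := ∑ i, dist (z i) (z (i + 1)) ^ 2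

theorem wirtinger (z : Fin 5 → ℂ) : 4 * tan36 * shoelace z ≤ sqLength z := by
  have := wirtinger_real (z 0).re (z 1).re (z 2).re (z 3).re (z 4).re (z 0).im (z 1).im (z 2).im
    (z 3).im (z 4).im
  simp only [shoelace, sqLength, dist_sq_eq, Fin.sum_univ_five]
  change 4 * tan36 * ((((z 0).re * (z 1).im - (z 0).im * (z 1).re)
    + ((z 1).re * (z 2).im - (z 1).im * (z 2).re) + ((z 2).re * (z 3).im - (z 2).im * (z 3).re)
    + ((z 3).re * (z 4).im - (z 3).im * (z 4).re)
    + ((z 4).re * (z 0).im - (z 4).im * (z 0).re)) / 2) ≤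
    ((z 1).re - (z 0).re) ^ 2 + ((z 1).im - (z 0).im) ^ 2
    + (((z 2).re - (z 1).re) ^ 2 + ((z 2).im - (z 1).im) ^ 2)
    + (((z 3).re - (z 2).re) ^ 2 + ((z 3).im - (z 2).im) ^ 2)
    + (((z 4).re - (z 3).re) ^ 2 + ((z 4).im - (z 3).im) ^ 2)
    + (((z 0).re - (z 4).re) ^ 2 + ((z 0).im - (z 4).im) ^ 2)
  linarith

theorem fin_five_ne : ∀ k : Fin 5, k - 1 ≠ k ∧ k + 1 ≠ k ∧ k + 2 ≠ k ∧ k + 3 ≠ k := by decide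

theorem fin_five_add : ∀ k : Fin 5, k - 1 + 1 = k ∧ k + 1 + 1 = k + 2 ∧ k + 2 + 1 = k + 3 ∧
    k + 3 + 1 = k - 1 ∧ k - 1 + 2 = k + 1 ∧ k - 1 + 3 = k + 2 ∧ k - 1 + 4 = k + 3 := by decide

/-- The descent step of `shoelace_le`: only the triangle at vertex k changes, and replacing two
unequal numbers by their mean strictly lowers the sum of squares. -/
theorem update_isosceles (z : Fin 5 → ℂ) (k : Fin 5) (h : dist (z (k - 1)) (z k) ≠
    dist (z k) (z (k + 1))) : ∃ v, pathLength (Function.update z k v) = pathLength z ∧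
    shoelace z ≤ shoelace (Function.update z k v) ∧
    sqLength (Function.update z k v) < sqLength z := by
  obtain ⟨v, h1, h2, h3⟩ := exists_isosceles (z (k - 1)) (z k) (z (k + 1))
  refine ⟨v, ?_⟩
  have hne : ∀ j : Fin 5, j ≠ k → Function.update z k v j = z j := fun j hj =>
    Function.update_of_ne hj _ _
  have hk : Function.update z k v k = v := Function.update_self _ _ _
  obtain ⟨a1, a2, a3, a4, e2, e3, e4⟩ := fin_five_add k
  have split : ∀ f : Fin 5 → ℝ, ∑ i, f i = f (k - 1) + f k + f (k + 1) + f (k + 2) + f (k + 3) := by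
    intro f
    rw [← Equiv.sum_comp (Equiv.addLeft (k - 1)), Fin.sum_univ_five]
    simp only [Equiv.coe_addLeft]
    rw [add_zero, a1, e2, e3, e4]
  obtain ⟨n1, n2, n3, n4⟩ := fin_five_ne k
  have hsq : 0 < (dist (z (k - 1)) (z k) - dist (z k) (z (k + 1))) ^ 2 := by
    have := sub_ne_zero.2 h
    positivity
  simp only [pathLength, sqLength, shoelace, split, a1, a2, a3, a4, hk, hne _ n1, hne _ n2,
    hne _ n3, hne _ n4, h1, h2]
  refine ⟨by ring, ?_, by nlinarith⟩
  simp only [cross] at h3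
  linarith

/-- The isoperimetric inequality for closed paths through five points. -/
theorem shoelace_le (z : Fin 5 → ℂ) : shoelace z ≤ pathLength z ^ 2 / (20 * tan36) := by
  have cS : Continuous shoelace := by unfold shoelace; fun_prop
  have cL : Continuous pathLength := by unfold pathLength; fun_prop
  have cE : Continuous sqLength := by unfold sqLength; fun_prop
  -- Pinning vertex 0 at the origin removes translations and makes the set of competitors compact.
  set K : Set (Fin 5 → ℂ) := {w | w 0 = 0 ∧ pathLength w ≤ pathLength z} with hK
  have hclosed : IsClosed K :=
    (isClosed_eq (continuous_apply 0) continuous_const).inter (isClosed_le cL continuous_const)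
  have hcompact : IsCompact K := by
    refine Metric.isCompact_of_isClosed_isBounded hclosed
      ((Metric.isBounded_closedBall (x := 0) (r := pathLength z)).subset ?_)
    rintro w ⟨h0, hw⟩
    rw [mem_closedBall_zero_iff, pi_norm_le_iff_of_nonneg
      (show 0 ≤ pathLength z from Finset.sum_nonneg fun _ _ => dist_nonneg)]
    have e := hw
    rw [show pathLength w = _ from Fin.sum_univ_five _] at e
    change dist (w 0) (w 1) + dist (w 1) (w 2) + dist (w 2) (w 3) + dist (w 3) (w 4)
      + dist (w 4) (w 0) ≤ _ at e
    rw [h0] at e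
    intro i
    refine le_trans ?_ e
    have := dist_nonneg (x := (0 : ℂ)) (y := w 1)
    have := dist_nonneg (x := w 1) (y := w 2)
    have := dist_nonneg (x := w 2) (y := w 3)
    have := dist_nonneg (x := w 3) (y := w 4)
    have := dist_nonneg (x := w 4) (y := 0)
    have := dist_triangle 0 (w 1) (w 2)
    have := dist_triangle 0 (w 2) (w 3)
    rw [← dist_zero_left]
    fin_cases i <;> simp only [Fin.zero_eta, Fin.mk_one, Fin.reduceFinMk, h0, dist_self] <;>
      first | positivity | linarith [dist_comm (w 4) 0]
  set z' : Fin 5 → ℂ := fun i => z i - z 0 with hz'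
  have hlen : pathLength z' = pathLength z := by simp [pathLength, hz']
  have hsh : shoelace z' = shoelace z := by
    simp only [shoelace, hz', Fin.sum_univ_five, Complex.sub_re, Complex.sub_im]
    change _ = (((z 0).re * (z 1).im - (z 0).im * (z 1).re)
      + ((z 1).re * (z 2).im - (z 1).im * (z 2).re) + ((z 2).re * (z 3).im - (z 2).im * (z 3).re)
      + ((z 3).re * (z 4).im - (z 3).im * (z 4).re)
      + ((z 4).re * (z 0).im - (z 4).im * (z 0).re)) / 2
    simp only [zero_add, Fin.reduceAdd, show (1 : Fin 5) + 1 = 2 from rfl]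
    ring
  have hz'K : z' ∈ K := ⟨by simp [hz'], hlen.le⟩
  obtain ⟨m, hmK, hm⟩ := hcompact.exists_isMaxOn ⟨z', hz'K⟩ cS.continuousOn
  -- Among the maximisers of the area, one with least sum of squared edges is chosen, so that
  -- `update_isosceles` cannot be applied to it.
  have hMc : IsCompact (K ∩ {w | shoelace m ≤ shoelace w}) :=
    hcompact.inter_right (isClosed_le continuous_const cS)
  obtain ⟨w, ⟨hwK, hwm⟩, hw⟩ := hMc.exists_isMinOn ⟨m, hmK, le_refl (shoelace m)⟩ cE.continuousOn
  -- The pinned vertex may not be moved, but the four equalities at the others already make all five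
  -- edges equal. Then the sum of squares is a fifth of the squared length.
  have heq : ∀ k : Fin 5, k ≠ 0 → dist (w (k - 1)) (w k) = dist (w k) (w (k + 1)) := by
    intro k hk
    by_contra hne
    obtain ⟨v, hv1, hv2, hv3⟩ := update_isosceles w k hne
    have := hw (a := Function.update w k v) ⟨⟨?_, ?_⟩, ?_⟩
    · exact absurd hv3 (not_lt.2 this)
    · rw [Function.update_of_ne hk.symm]; exact hwK.1
    · rw [hv1]; exact hwK.2
    · exact le_trans hwm hv2
  have d1 : dist (w 0) (w 1) = dist (w 1) (w 2) := heq 1 (by decide)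
  have d2 : dist (w 1) (w 2) = dist (w 2) (w 3) := heq 2 (by decide)
  have d3 : dist (w 2) (w 3) = dist (w 3) (w 4) := heq 3 (by decide)
  have d4 : dist (w 3) (w 4) = dist (w 4) (w 0) := heq 4 (by decide)
  have hL : pathLength w = 5 * dist (w 4) (w 0) := by
    simp only [pathLength, Fin.sum_univ_five]
    change dist (w 0) (w 1) + dist (w 1) (w 2) + dist (w 2) (w 3) + dist (w 3) (w 4)
      + dist (w 4) (w 0) = _
    linarith
  have hE : sqLength w = 5 * dist (w 4) (w 0) ^ 2 := by
    simp only [sqLength, Fin.sum_univ_five]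
    change dist (w 0) (w 1) ^ 2 + dist (w 1) (w 2) ^ 2 + dist (w 2) (w 3) ^ 2
      + dist (w 3) (w 4) ^ 2 + dist (w 4) (w 0) ^ 2 = _
    rw [d1, d2, d3, d4]
    ring
  have hW := wirtinger w
  have ht := lt_tan36
  have hle : shoelace z ≤ shoelace w := by
    rw [← hsh]; exact le_trans (hm hz'K) hwm
  have hLz := hwK.2
  rw [hL] at hLz
  have := dist_nonneg (x := w 4) (y := w 0)
  rw [le_div_iff₀ (by linarith)]
  nlinarith

/-! ### Areas of triangles -/

theorem cross_combo (a b x y : ℂ) {s t : ℝ} (h : s + t = 1) :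
    cross a b (s • x + t • y) = s * cross a b x + t * cross a b y := by
  obtain rfl : s = 1 - t := by linarith
  simp only [cross, Complex.add_re, Complex.add_im, Complex.real_smul, Complex.re_ofReal_mul,
    Complex.im_ofReal_mul]
  ring

theorem convex_halfPlane (a b : ℂ) : Convex ℝ {p | 0 ≤ cross a b p} := by
  intro x hx y hy s t hs ht hst
  simp only [mem_ofPred_eq] at *
  rw [cross_combo a b x y hst]
  positivity

/-- The barycentric coordinates of x are ratios of signed areas. -/
theorem mem_triangle {a b c x : ℂ} (h : 0 < cross a b c) (h1 : 0 ≤ cross a b x)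
    (h2 : 0 ≤ cross b c x) (h3 : 0 ≤ cross c a x) : x ∈ convexHull ℝ {a, b, c} := by
  have hsum : cross b c x + cross c a x + cross a b x = cross a b c := by simp only [cross]; ring
  have hx : x = (cross b c x / cross a b c) • a + (cross c a x / cross a b c) • b
      + (cross a b x / cross a b c) • c := by
    have h0 := h.ne'
    apply Complex.ext <;>
    simp only [Complex.add_re, Complex.add_im, Complex.real_smul, Complex.re_ofReal_mul,
      Complex.im_ofReal_mul] <;> field_simp <;> simp only [cross] <;> ring
  rw [hx]
  refine (convex_convexHull ℝ _).sum_mem (t := Finset.univ) (w := ![cross b c x / cross a b c,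
    cross c a x / cross a b c, cross a b x / cross a b c]) (z := ![a, b, c]) ?_ ?_ ?_ |>
    (by simpa [Fin.sum_univ_three] using ·)
  · intro i _
    fin_cases i <;> simp <;> positivity
  · simp only [Fin.sum_univ_three, Matrix.cons_val]
    rw [← add_div, ← add_div, hsum, div_self h.ne']
  · intro i _
    apply subset_convexHull
    fin_cases i <;> simp

theorem volume_standard_triangle :
    volume (convexHull ℝ {(0 : ℂ), 1, Complex.I}) ≤ ENNReal.ofReal (1 / 2) := by
  have hsub : convexHull ℝ {(0 : ℂ), 1, Complex.I} ⊆
      Complex.measurableEquivRealProd ⁻¹' {p | (0 ≤ p.1 ∧ 0 ≤ p.2) ∧ p.1 + p.2 ≤ 1} := by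
    refine convexHull_min ?_ ?_
    · rintro x (rfl | rfl | rfl) <;> simp [Complex.measurableEquivRealProd]
    · intro x hx y hy s t hs ht hst
      simp only [mem_preimage, mem_ofPred_eq, Complex.measurableEquivRealProd_apply,
        Complex.add_re, Complex.add_im, Complex.real_smul, Complex.re_ofReal_mul,
        Complex.im_ofReal_mul] at *
      obtain ⟨⟨hx1, hx2⟩, hx3⟩ := hx
      obtain ⟨⟨hy1, hy2⟩, hy3⟩ := hy
      refine ⟨⟨by positivity, by positivity⟩, ?_⟩
      nlinarith
  have hm : MeasurableSet {p : ℝ × ℝ | (0 ≤ p.1 ∧ 0 ≤ p.2) ∧ p.1 + p.2 ≤ 1} := by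
    refine MeasurableSet.inter (MeasurableSet.inter ?_ ?_) ?_
    · exact measurableSet_le measurable_const measurable_fst
    · exact measurableSet_le measurable_const measurable_snd
    · exact measurableSet_le (measurable_fst.add measurable_snd) measurable_const
  refine (measure_mono hsub).trans ?_
  rw [Complex.volume_preserving_equiv_real_prod.measure_preimage hm.nullMeasurableSet,
    Measure.volume_eq_prod, Measure.prod_apply hm]
  calc _ ≤ ∫⁻ x, (Icc (0 : ℝ) 1).indicator (fun x => ENNReal.ofReal (1 - x)) x := by
        refine lintegral_mono fun x => ?_
        by_cases hx : x ∈ Icc (0 : ℝ) 1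
        · rw [indicator_of_mem hx]
          have : Prod.mk x ⁻¹' {p : ℝ × ℝ | (0 ≤ p.1 ∧ 0 ≤ p.2) ∧ p.1 + p.2 ≤ 1} ⊆ Icc 0 (1 - x) := by
            rintro y ⟨⟨_, h2⟩, h3⟩
            exact ⟨h2, by simp only at h3; linarith⟩
          refine (measure_mono this).trans ?_
          rw [Real.volume_Icc, sub_zero]
        · have : Prod.mk x ⁻¹' {p : ℝ × ℝ | (0 ≤ p.1 ∧ 0 ≤ p.2) ∧ p.1 + p.2 ≤ 1} = ∅ := by
            ext y
            simp only [mem_preimage, mem_ofPred_eq, mem_empty_iff_false, iff_false]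
            rintro ⟨⟨h1, h2⟩, h3⟩
            exact hx ⟨h1, by linarith⟩
          simp [this]
    _ = ∫⁻ x in Icc (0 : ℝ) 1, ENNReal.ofReal (1 - x) := lintegral_indicator measurableSet_Icc _
    _ = ENNReal.ofReal (∫ x in Icc (0 : ℝ) 1, (1 - x)) := by
        rw [ofReal_integral_eq_lintegral_ofReal]
        · exact (by fun_prop : Continuous fun x : ℝ => 1 - x).integrableOn_Icc
        · filter_upwards [ae_restrict_mem measurableSet_Icc] with x hx
          simpa using hx.2
    _ ≤ _ := by
        apply ENNReal.ofReal_le_ofReal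
        rw [integral_Icc_eq_integral_Ioc, ← intervalIntegral.integral_of_le zero_le_one]
        rw [intervalIntegral.integral_sub (by simp) (by simp)]
        norm_num [integral_id]

theorem volume_triangle (a b c : ℂ) :
    volume (convexHull ℝ {a, b, c}) ≤ ENNReal.ofReal (|cross a b c| / 2) := by
  set M : Matrix (Fin 2) (Fin 2) ℝ := !![b.re - a.re, c.re - a.re; b.im - a.im, c.im - a.im]
  set f : ℂ →ₗ[ℝ] ℂ := Matrix.toLin Complex.basisOneI Complex.basisOneI M with hf
  have hdet : LinearMap.det f = cross a b c := by
    rw [hf, LinearMap.det_toLin, Matrix.det_fin_two_of, cross]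
    ring
  have f1 : f 1 = b - a := by
    have := Matrix.toLin_self Complex.basisOneI Complex.basisOneI M 0
    simp only [Complex.coe_basisOneI, Matrix.cons_val_zero] at this
    rw [hf, this]
    apply Complex.ext <;> simp [M]
  have fI : f Complex.I = c - a := by
    have := Matrix.toLin_self Complex.basisOneI Complex.basisOneI M 1
    simp only [Complex.coe_basisOneI] at this
    change f Complex.I = _ at this
    rw [this]
    apply Complex.ext <;> simp [M]
  have himg : convexHull ℝ {a, b, c} = (fun z => a + z) '' (f '' convexHull ℝ {(0 : ℂ), 1, Complex.I}) := by
    have h := convexHull_vadd (𝕜 := ℝ) a (f '' {0, 1, Complex.I})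
    rw [← LinearMap.image_convexHull] at h
    refine Eq.trans ?_ h
    rw [image_insert_eq, image_pair, map_zero, f1, fI, ← image_vadd, image_insert_eq, image_pair]
    simp only [vadd_eq_add, add_zero, add_sub_cancel]
  rw [himg, image_add_left, measure_preimage_add, Measure.addHaar_image_linearMap, hdet]
  calc _ ≤ ENNReal.ofReal |cross a b c| * ENNReal.ofReal (1 / 2) := by
        gcongr; exact volume_standard_triangle
    _ = _ := by rw [← ENNReal.ofReal_mul (abs_nonneg _)]; congr 1; ring

/-- Lagrange's identity: the squares of the cross product and of the dot product add up to the
product of the squared lengths. -/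
theorem abs_cross_le (a b c : ℂ) : |cross a b c| ≤ dist a b * dist b c := by
  apply abs_le_of_sq_le_sq _ (by positivity)
  rw [mul_pow, dist_sq_eq, dist_sq_eq, cross]
  nlinarith [sq_nonneg ((b.re - a.re) * (c.re - b.re) + (b.im - a.im) * (c.im - b.im))]

/-- The isoperimetric inequality for triangles. -/
theorem volume_triangle_le (a b c : ℂ) : volume (convexHull ℝ {a, b, c}) ≤
    ENNReal.ofReal ((dist a b + dist b c + dist c a) ^ 2 / (12 * √3)) := by
  refine (volume_triangle a b c).trans (ENNReal.ofReal_le_ofReal ?_)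
  have h3 : √3 ^ 2 = 3 := Real.sq_sqrt (by norm_num)
  apply le_of_sq_le_sq _ (by positivity)
  rw [div_pow, sq_abs, div_pow, mul_pow, h3]
  have hc := cross_sq a b c
  rw [dist_comm c a]
  have t1 := dist_triangle a b c
  have t2 := dist_triangle a c b
  have t3 := dist_triangle b a c
  rw [dist_comm c b] at t2
  rw [dist_comm b a] at t3
  set p := dist a b
  set q := dist b c
  set d := dist a c
  -- AM-GM for the three Heron factors, whose sum is the perimeter.
  have amgm : 27 * ((p + d - q) * (p + q - d) * (q + d - p)) ≤ (p + q + d) ^ 3 := by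
    have hx : 0 ≤ p + d - q := by linarith
    have hy : 0 ≤ p + q - d := by linarith
    have hz : 0 ≤ q + d - p := by linarith
    have hs : p + q + d = (p + d - q) + (p + q - d) + (q + d - p) := by ring
    rw [hs]
    generalize p + d - q = x at *
    generalize p + q - d = y at *
    generalize q + d - p = z at *
    nlinarith [mul_nonneg hx (sq_nonneg (y - z)), mul_nonneg hy (sq_nonneg (x - z)),
      mul_nonneg hz (sq_nonneg (x - y)), mul_nonneg hx (sq_nonneg (x - y)),
      mul_nonneg hx (sq_nonneg (x - z)), mul_nonneg hy (sq_nonneg (x - y)),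
      mul_nonneg hy (sq_nonneg (y - z)), mul_nonneg hz (sq_nonneg (x - z)),
      mul_nonneg hz (sq_nonneg (y - z))]
  have hnn : 0 ≤ p + q + d := by positivity
  have := mul_le_mul_of_nonneg_left amgm hnn
  nlinarith

/-! ### Quadrilaterals -/

/-- Four points of the plane are affinely dependent and so have a Radon partition. Convex position
excludes the partitions with a part of at most one point, and a partition 2 + 2 is a crossing. -/
theorem exists_segments_inter {a b c d : ℂ} (ha : a ∉ convexHull ℝ {b, c, d})
    (hb : b ∉ convexHull ℝ {a, c, d}) (hc : c ∉ convexHull ℝ {a, b, d})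
    (hd : d ∉ convexHull ℝ {a, b, c}) :
    (segment ℝ a b ∩ segment ℝ c d).Nonempty ∨ (segment ℝ a c ∩ segment ℝ b d).Nonempty ∨
      (segment ℝ a d ∩ segment ℝ b c).Nonempty := by
  have hdep : ¬ AffineIndependent ℝ ![a, b, c, d] := by
    intro h
    have := h.card_le_finrank_succ
    have h2 : Module.finrank ℝ (vectorSpan ℝ (range ![a, b, c, d])) ≤ 2 := by
      rw [← Complex.finrank_real_complex]
      exact Submodule.finrank_le _
    simp at this
    omega
  obtain ⟨I, p, hp1, hp2⟩ := Convex.radon_partition hdep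
  wlog h0 : (0 : Fin 4) ∈ I generalizing I
  · exact this Iᶜ hp2 (by rwa [compl_compl]) h0
  have sub : ∀ (J : Set (Fin 4)) (A : Set ℂ), p ∈ convexHull ℝ (![a, b, c, d] '' J) →
      (∀ i ∈ J, ![a, b, c, d] i ∈ A) → p ∈ convexHull ℝ A := fun J A h1 h2 =>
    convexHull_mono (image_subset_iff.2 h2) h1
  have hI : ∀ A : Set ℂ, (0 ∈ I → a ∈ A) → (1 ∈ I → b ∈ A) → (2 ∈ I → c ∈ A) →
      (3 ∈ I → d ∈ A) → p ∈ convexHull ℝ A := fun A k0 k1 k2 k3 =>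
    sub I A hp1 (by intro i; fin_cases i <;> assumption)
  have hJ : ∀ A : Set ℂ, (0 ∉ I → a ∈ A) → (1 ∉ I → b ∈ A) → (2 ∉ I → c ∈ A) →
      (3 ∉ I → d ∈ A) → p ∈ convexHull ℝ A := fun A k0 k1 k2 k3 =>
    sub Iᶜ A hp2 (by intro i; fin_cases i <;> assumption)
  clear sub hp1 hp2 hdep
  by_cases h1 : (1 : Fin 4) ∈ I <;> by_cases h2 : (2 : Fin 4) ∈ I <;>
    by_cases h3 : (3 : Fin 4) ∈ I
  · have := hJ ∅ (by simp [h0]) (by simp [h1]) (by simp [h2]) (by simp [h3])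
    simp at this
  · have := hJ {d} (by simp [h0]) (by simp [h1]) (by simp [h2]) (by simp [h3])
    rw [convexHull_singleton, mem_singleton_iff] at this
    exact absurd (this ▸ hI {a, b, c} (by simp [h0]) (by simp [h1]) (by simp [h2]) (by simp [h3])) hd
  · have := hJ {c} (by simp [h0]) (by simp [h1]) (by simp [h2]) (by simp [h3])
    rw [convexHull_singleton, mem_singleton_iff] at this
    exact absurd (this ▸ hI {a, b, d} (by simp [h0]) (by simp [h1]) (by simp [h2]) (by simp [h3])) hc
  · left
    rw [← convexHull_pair, ← convexHull_pair]
    exact ⟨p, hI _ (by simp [h0]) (by simp [h1]) (by simp [h2]) (by simp [h3]),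
      hJ _ (by simp [h0]) (by simp [h1]) (by simp [h2]) (by simp [h3])⟩
  · have := hJ {b} (by simp [h0]) (by simp [h1]) (by simp [h2]) (by simp [h3])
    rw [convexHull_singleton, mem_singleton_iff] at this
    exact absurd (this ▸ hI {a, c, d} (by simp [h0]) (by simp [h1]) (by simp [h2]) (by simp [h3])) hb
  · right; left
    rw [← convexHull_pair, ← convexHull_pair]
    exact ⟨p, hI _ (by simp [h0]) (by simp [h1]) (by simp [h2]) (by simp [h3]),
      hJ _ (by simp [h0]) (by simp [h1]) (by simp [h2]) (by simp [h3])⟩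
  · right; right
    rw [← convexHull_pair, ← convexHull_pair]
    exact ⟨p, hI _ (by simp [h0]) (by simp [h1]) (by simp [h2]) (by simp [h3]),
      hJ _ (by simp [h0]) (by simp [h1]) (by simp [h2]) (by simp [h3])⟩
  · have := hI {a} (by simp [h0]) (by simp [h1]) (by simp [h2]) (by simp [h3])
    rw [convexHull_singleton, mem_singleton_iff] at this
    exact absurd (this ▸ hJ {b, c, d} (by simp [h0]) (by simp [h1]) (by simp [h2]) (by simp [h3])) ha

/-- The crossing gives s₁a + s₂c = t₁b + t₂d. Weight on b and d is traded along this relation for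
weight on a and c until b or d is used up. -/
theorem convexHull_subset_union_triangles {a b c d p : ℂ} (h1 : p ∈ segment ℝ a c)
    (h2 : p ∈ segment ℝ b d) :
    convexHull ℝ {a, b, c, d} ⊆ convexHull ℝ {a, b, c} ∪ convexHull ℝ {c, d, a} := by
  have comb : ∀ x y z : ℂ, ∀ α β γ : ℝ, 0 ≤ α → 0 ≤ β → 0 ≤ γ → α + β + γ = 1 →
      α • x + β • y + γ • z ∈ convexHull ℝ {x, y, z} := by
    intro x y z α β γ hα hβ hγ hs
    refine (convex_convexHull ℝ _).sum_mem (t := Finset.univ) (w := ![α, β, γ])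
      (z := ![x, y, z]) ?_ ?_ ?_ |> (by simpa [Fin.sum_univ_three] using ·)
    · intro i _
      fin_cases i <;> assumption
    · simpa [Fin.sum_univ_three] using hs
    · intro i _
      apply subset_convexHull
      fin_cases i <;> simp
  obtain ⟨s₁, s₂, hs₁, hs₂, hs, rfl⟩ := h1
  obtain ⟨t₁, t₂, ht₁, ht₂, ht, hp⟩ := h2
  intro x hx
  have hx' : ∃ α β γ δ : ℝ, 0 ≤ α ∧ 0 ≤ β ∧ 0 ≤ γ ∧ 0 ≤ δ ∧ α + β + γ + δ = 1 ∧
      α • a + β • b + γ • c + δ • d = x := by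
    rw [convexHull_insert (by simp), convexHull_insert (by simp), convexHull_pair] at hx
    simp only [mem_convexJoin, mem_singleton_iff, exists_eq_left] at hx
    obtain ⟨u, ⟨v, ⟨k₁, k₂, hk₁, hk₂, hk, rfl⟩, ⟨l₁, l₂, hl₁, hl₂, hl, rfl⟩⟩,
      ⟨m₁, m₂, hm₁, hm₂, hm, rfl⟩⟩ := hx
    refine ⟨m₁, m₂ * l₁, m₂ * (l₂ * k₁), m₂ * (l₂ * k₂), hm₁, by positivity, by positivity,
      by positivity, ?_, ?_⟩
    · linear_combination hm + m₂ * hl + m₂ * l₂ * hk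
    · module
  obtain ⟨α, β, γ, δ, hα, hβ, hγ, hδ, hsum, rfl⟩ := hx'
  rcases le_total (β * t₂) (δ * t₁) with h | h
  · right
    obtain ⟨l, hl0, hl1, hl2⟩ : ∃ l, 0 ≤ l ∧ l * t₁ = β ∧ l * t₂ ≤ δ := by
      -- If t₁ = 0, the case assumption already forces β = 0 and nothing has to be traded.
      rcases ht₁.eq_or_lt with h0 | h0
      · refine ⟨0, le_rfl, ?_, by simpa using hδ⟩
        have : t₂ = 1 := by linarith
        rw [← h0, this] at h
        linarith
      · refine ⟨β / t₁, by positivity, by field_simp, ?_⟩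
        rw [div_mul_eq_mul_div, div_le_iff₀ h0]
        exact h
    have e : α • a + β • b + γ • c + δ • d =
        (γ + l * s₂) • c + (δ - l * t₂) • d + (α + l * s₁) • a := by
      rw [← hl1]
      linear_combination (norm := module) l • hp
    rw [e]
    refine comb _ _ _ _ _ _ (by positivity) (by linarith) (by positivity) ?_
    linear_combination hsum + l * hs - l * ht + hl1
  · left
    obtain ⟨l, hl0, hl1, hl2⟩ : ∃ l, 0 ≤ l ∧ l * t₂ = δ ∧ l * t₁ ≤ β := by
      rcases ht₂.eq_or_lt with h0 | h0
      · refine ⟨0, le_rfl, ?_, by simpa using hβ⟩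
        have : t₁ = 1 := by linarith
        rw [← h0, this] at h
        linarith
      · refine ⟨δ / t₂, by positivity, by field_simp, ?_⟩
        rw [div_mul_eq_mul_div, div_le_iff₀ h0]
        exact h
    have e : α • a + β • b + γ • c + δ • d =
        (α + l * s₁) • a + (β - l * t₁) • b + (γ + l * s₂) • c := by
      rw [← hl1]
      linear_combination (norm := module) l • hp
    rw [e]
    refine comb _ _ _ _ _ _ (by positivity) (by linarith) (by positivity) ?_
    linear_combination hsum + l * hs - l * ht + hl1

theorem volume_quad_le_add {a b c d p : ℂ} (h1 : p ∈ segment ℝ a c) (h2 : p ∈ segment ℝ b d) :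
    volume (convexHull ℝ {a, b, c, d}) ≤
      ENNReal.ofReal ((dist a b * dist b c + dist c d * dist d a) / 2) := by
  refine (measure_mono (convexHull_subset_union_triangles h1 h2)).trans
    ((measure_union_le _ _).trans ?_)
  refine (add_le_add (volume_triangle _ _ _) (volume_triangle _ _ _)).trans ?_
  rw [← ENNReal.ofReal_add (by positivity) (by positivity)]
  apply ENNReal.ofReal_le_ofReal
  have := abs_cross_le a b c
  have := abs_cross_le c d a
  linarith

/-- Cutting along either diagonal bounds the area; the mean of the two bounds is (ab + cd)(bc +
da)/4, where ab denotes the distance from a to b, and this is at most L²/16 for the perimeter L. -/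
theorem volume_quad_le_of_diagonals {a b c d p : ℂ} (h1 : p ∈ segment ℝ a c)
    (h2 : p ∈ segment ℝ b d) : volume (convexHull ℝ {a, b, c, d}) ≤
      ENNReal.ofReal ((dist a b + dist b c + dist c d + dist d a) ^ 2 / 16) := by
  have v1 := volume_quad_le_add h1 h2
  have v2 := volume_quad_le_add h2 (segment_symm ℝ a c ▸ h1)
  have hset : ({b, c, d, a} : Set ℂ) = {a, b, c, d} := by
    ext; simp only [mem_insert_iff, mem_singleton_iff]; tauto
  rw [hset] at v2
  have hsq := sq_nonneg ((dist a b + dist c d) - (dist b c + dist d a))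
  rcases le_total (dist a b * dist b c + dist c d * dist d a)
    (dist b c * dist c d + dist d a * dist a b) with h | h
  · refine v1.trans (ENNReal.ofReal_le_ofReal ?_)
    nlinarith
  · refine v2.trans (ENNReal.ofReal_le_ofReal ?_)
    nlinarith

/-- If two segments cross, exchanging them for two opposite sides of the quadrilateral that they
span shortens the total length. -/
theorem dist_add_dist_le_of_segments {a b c d p : ℂ} (h1 : p ∈ segment ℝ a b)
    (h2 : p ∈ segment ℝ c d) : dist a c + dist b d ≤ dist a b + dist c d := by
  have e1 := dist_add_dist_of_mem_segment h1
  have e2 := dist_add_dist_of_mem_segment h2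
  have := dist_triangle a p c
  have := dist_triangle b p d
  rw [dist_comm p b] at e1
  rw [dist_comm c p] at e2
  linarith

/-- The isoperimetric inequality for the convex hull of a closed path through four points. -/
theorem volume_quad_le (a b c d : ℂ) : volume (convexHull ℝ {a, b, c, d}) ≤
    ENNReal.ofReal ((dist a b + dist b c + dist c d + dist d a) ^ 2 / 16) := by
  have h3 : 16 ≤ 12 * √3 := by
    have : 1.7 ≤ √3 := Real.le_sqrt_of_sq_le (by norm_num)
    linarith
  have tri : ∀ x y z w : ℂ, x ∈ convexHull ℝ {y, z, w} →
      ({x, y, z, w} : Set ℂ) = {a, b, c, d} →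
      dist y z + dist z w + dist w y ≤ dist a b + dist b c + dist c d + dist d a →
      volume (convexHull ℝ {a, b, c, d}) ≤
        ENNReal.ofReal ((dist a b + dist b c + dist c d + dist d a) ^ 2 / 16) := by
    intro x y z w hx hset hlen
    have : convexHull ℝ {a, b, c, d} ⊆ convexHull ℝ {y, z, w} := by
      rw [← hset]
      exact convexHull_min (insert_subset hx (subset_convexHull ℝ _)) (convex_convexHull ℝ _)
    refine (measure_mono this).trans ((volume_triangle_le _ _ _).trans
      (ENNReal.ofReal_le_ofReal ?_))
    gcongr
  by_cases ha : a ∈ convexHull ℝ {b, c, d}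
  · refine tri a b c d ha rfl ?_
    linarith [dist_triangle d a b]
  by_cases hb : b ∈ convexHull ℝ {a, c, d}
  · refine tri b a c d hb ?_ ?_
    · ext; simp only [mem_insert_iff, mem_singleton_iff]; tauto
    · linarith [dist_triangle a b c]
  by_cases hc : c ∈ convexHull ℝ {a, b, d}
  · refine tri c a b d hc ?_ ?_
    · ext; simp only [mem_insert_iff, mem_singleton_iff]; tauto
    · linarith [dist_triangle b c d]
  by_cases hd : d ∈ convexHull ℝ {a, b, c}
  · refine tri d a b c hd ?_ ?_
    · ext; simp only [mem_insert_iff, mem_singleton_iff]; tauto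
    · linarith [dist_triangle c d a]
  -- If the crossing pair is a pair of opposite edges of the path, uncrossing it gives a path
  -- through the same points, no longer than before, whose diagonals cross.
  rcases exists_segments_inter ha hb hc hd with ⟨p, h1, h2⟩ | ⟨p, h1, h2⟩ | ⟨p, h1, h2⟩
  · have hset : ({a, c, b, d} : Set ℂ) = {a, b, c, d} := by
      ext; simp only [mem_insert_iff, mem_singleton_iff]; tauto
    rw [← hset]
    refine (volume_quad_le_of_diagonals h1 h2).trans (ENNReal.ofReal_le_ofReal ?_)
    have := dist_add_dist_le_of_segments h1 h2
    rw [dist_comm c b]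
    gcongr ?_ ^ 2 / 16
    linarith
  · exact volume_quad_le_of_diagonals h1 h2
  · have hset : ({a, b, d, c} : Set ℂ) = {a, b, c, d} := by
      ext; simp only [mem_insert_iff, mem_singleton_iff]; tauto
    rw [← hset]
    refine (volume_quad_le_of_diagonals h1 h2).trans (ENNReal.ofReal_le_ofReal ?_)
    have := dist_add_dist_le_of_segments h1 (segment_symm ℝ b c ▸ h2)
    rw [dist_comm d c, dist_comm d a, dist_comm c a]
    rw [dist_comm c b] at this
    rw [dist_comm d b] at this
    gcongr ?_ ^ 2 / 16
    linarith

/-! ### Convex pentagons -/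

theorem mem_segment_of_cross_eq_zero {a b c : ℂ} (h : cross a b c = 0) :
    a ∈ segment ℝ b c ∨ b ∈ segment ℝ a c ∨ c ∈ segment ℝ a b := by
  have hcol : Collinear ℝ {a, b, c} := by
    rcases eq_or_ne a b with rfl | hab
    · simpa using collinear_pair ℝ a c
    rw [collinear_iff_of_mem (p₀ := a) (by simp)]
    refine ⟨b - a, ?_⟩
    have hd : 0 < (b.re - a.re) ^ 2 + (b.im - a.im) ^ 2 := by
      rw [← dist_sq_eq]
      exact pow_pos (dist_pos.2 hab) 2
    have hd0 := hd.ne'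
    rintro x (rfl | rfl | rfl)
    · exact ⟨0, by simp⟩
    · exact ⟨1, by simp⟩
    · refine ⟨((b.re - a.re) * (x.re - a.re) + (b.im - a.im) * (x.im - a.im)) /
        ((b.re - a.re) ^ 2 + (b.im - a.im) ^ 2), ?_⟩
      rw [cross] at h
      apply Complex.ext <;> simp only [vadd_eq_add, Complex.add_re, Complex.add_im,
        Complex.real_smul, Complex.re_ofReal_mul, Complex.im_ofReal_mul, Complex.sub_re,
        Complex.sub_im] <;> field_simp
      · linear_combination -(b.im - a.im) * h
      · linear_combination (b.re - a.re) * h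
  rcases hcol.wbtw_or_wbtw_or_wbtw with h | h | h
  · exact Or.inr (Or.inl h.mem_segment)
  · exact Or.inr (Or.inr (segment_symm ℝ b a ▸ h.mem_segment))
  · exact Or.inl (segment_symm ℝ c b ▸ h.mem_segment)

/-- If c and d were on opposite sides of the line ab, neither ac, bd nor ad, bc could cross in
convex position, which leaves only the excluded crossing of ab and cd. -/
theorem cross_mul_pos {a b c d : ℂ} (ha : a ∉ convexHull ℝ {b, c, d})
    (hb : b ∉ convexHull ℝ {a, c, d}) (hc : c ∉ convexHull ℝ {a, b, d})
    (hd : d ∉ convexHull ℝ {a, b, c}) (hdisj : Disjoint (segment ℝ a b) (segment ℝ c d)) :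
    0 < cross a b c * cross a b d := by
  have seg : ∀ {x y : ℂ} {A : Set ℂ} {p : ℂ}, p ∉ convexHull ℝ A → x ∈ A → y ∈ A →
      p ∉ segment ℝ x y := fun h hx hy hp => h (segment_subset_convexHull hx hy hp)
  have hc0 : cross a b c ≠ 0 := by
    intro h
    rcases mem_segment_of_cross_eq_zero h with h | h | h
    · exact seg ha (by simp) (by simp) h
    · exact seg hb (by simp) (by simp) h
    · exact seg hc (by simp) (by simp) h
  have hd0 : cross a b d ≠ 0 := by
    intro h
    rcases mem_segment_of_cross_eq_zero h with h | h | h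
    · exact seg ha (by simp) (by simp) h
    · exact seg hb (by simp) (by simp) h
    · exact seg hd (by simp) (by simp) h
  have caa : cross a b a = 0 := by simp [cross]
  have cab : cross a b b = 0 := by simp [cross]; ring
  by_contra hneg
  have main : ∀ s t : ℝ, 0 ≤ s → 0 ≤ t → s * cross a b c = t * cross a b d → s = 0 := by
    intro s t hs ht h
    by_contra hs0
    have hs' : 0 < s := lt_of_le_of_ne hs (Ne.symm hs0)
    have h1 : 0 < s * cross a b c ^ 2 := by positivity
    have h2 : s * cross a b c ^ 2 = t * (cross a b c * cross a b d) := by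
      linear_combination cross a b c * h
    nlinarith
  rcases exists_segments_inter ha hb hc hd with ⟨p, h1, h2⟩ | ⟨p, h1, h2⟩ | ⟨p, h1, h2⟩
  · exact disjoint_left.1 hdisj h1 h2
  · obtain ⟨s₁, s₂, hs₁, hs₂, hs, rfl⟩ := h1
    obtain ⟨t₁, t₂, ht₁, ht₂, ht, hp⟩ := h2
    have e := congrArg (cross a b) hp
    rw [cross_combo _ _ _ _ hs, cross_combo _ _ _ _ ht, caa, cab] at e
    have : s₂ = 0 := main s₂ t₂ hs₂ ht₂ (by linarith)
    have h1 : s₁ = 1 := by linarith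
    rw [this, h1] at hp
    refine seg ha (x := b) (y := d) (by simp) (by simp) ⟨t₁, t₂, ht₁, ht₂, ht, ?_⟩
    rw [hp]; simp
  · obtain ⟨s₁, s₂, hs₁, hs₂, hs, rfl⟩ := h1
    obtain ⟨t₁, t₂, ht₁, ht₂, ht, hp⟩ := h2
    have e := congrArg (cross a b) hp
    rw [cross_combo _ _ _ _ hs, cross_combo _ _ _ _ ht, caa, cab] at e
    have : t₂ = 0 := main t₂ s₂ ht₂ hs₂ (by linarith)
    have h1 : t₁ = 1 := by linarith
    rw [this, h1] at hp
    refine seg hb (x := a) (y := d) (by simp) (by simp) ⟨s₁, s₂, hs₁, hs₂, hs, ?_⟩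
    rw [← hp]; simp

/-- The pentagon is covered by a fan of three triangles at vertex 0, whose signed areas add up to
the shoelace sum. -/
theorem volume_convex_pentagon (z : Fin 5 → ℂ)
    (h : ∀ i j, j ≠ i → j ≠ i + 1 → 0 < cross (z i) (z (i + 1)) (z j)) :
    volume (convexHull ℝ (range z)) ≤ ENNReal.ofReal (shoelace z) := by
  have hp : ∀ p ∈ convexHull ℝ (range z), ∀ i, 0 ≤ cross (z i) (z (i + 1)) p := by
    intro p hp i
    refine convexHull_min (t := {p | 0 ≤ cross (z i) (z (i + 1)) p}) ?_
      (convex_halfPlane (z i) (z (i + 1))) hp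
    rintro _ ⟨j, rfl⟩
    rcases eq_or_ne j i with rfl | h1
    · simp [cross]
    rcases eq_or_ne j (i + 1) with rfl | h2
    · have : cross (z i) (z (i + 1)) (z (i + 1)) = 0 := by simp only [cross]; ring
      exact this.ge
    exact (h i j h1 h2).le
  have c012 : 0 < cross (z 0) (z 1) (z 2) := h 0 2 (by decide) (by decide)
  have c340 : 0 < cross (z 3) (z 4) (z 0) := h 3 0 (by decide) (by decide)
  have c230 : 0 < cross (z 2) (z 3) (z 0) := h 2 0 (by decide) (by decide)
  have cover : convexHull ℝ (range z) ⊆ convexHull ℝ {z 0, z 1, z 2} ∪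
      (convexHull ℝ {z 2, z 3, z 0} ∪ convexHull ℝ {z 3, z 4, z 0}) := by
    intro p hpz
    have h0 : 0 ≤ cross (z 0) (z 1) p := hp p hpz 0
    have h1 : 0 ≤ cross (z 1) (z 2) p := hp p hpz 1
    have h2 : 0 ≤ cross (z 2) (z 3) p := hp p hpz 2
    have h3 : 0 ≤ cross (z 3) (z 4) p := hp p hpz 3
    have h4 : 0 ≤ cross (z 4) (z 0) p := hp p hpz 4
    have neg : ∀ x y : ℂ, cross x y p = -cross y x p := by intro x y; simp only [cross]; ring
    rcases le_total 0 (cross (z 2) (z 0) p) with h5 | h5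
    · exact Or.inl (mem_triangle c012 h0 h1 h5)
    rcases le_total 0 (cross (z 3) (z 0) p) with h6 | h6
    · refine Or.inr (Or.inl (mem_triangle c230 h2 h6 ?_))
      rw [neg]; linarith
    · refine Or.inr (Or.inr (mem_triangle c340 h3 h4 ?_))
      rw [neg]; linarith
  refine (measure_mono cover).trans ((measure_union_le _ _).trans
    ((add_le_add (le_refl (volume (convexHull ℝ {z 0, z 1, z 2}))) (measure_union_le _ _)).trans
    ((add_le_add (volume_triangle _ _ _) (add_le_add (volume_triangle _ _ _)
      (volume_triangle _ _ _))).trans ?_)))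
  rw [abs_of_pos c012, abs_of_pos c340, abs_of_pos c230, ← ENNReal.ofReal_add (by positivity)
    (by positivity), ← ENNReal.ofReal_add (by positivity) (by positivity)]
  apply ENNReal.ofReal_le_ofReal
  have e : shoelace z = (((z 0).re * (z 1).im - (z 0).im * (z 1).re)
      + ((z 1).re * (z 2).im - (z 1).im * (z 2).re) + ((z 2).re * (z 3).im - (z 2).im * (z 3).re)
      + ((z 3).re * (z 4).im - (z 3).im * (z 4).re)
      + ((z 4).re * (z 0).im - (z 4).im * (z 0).re)) / 2 := by
    rw [shoelace, Fin.sum_univ_five]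
    rfl
  rw [e]
  simp only [cross]
  linarith

/-- The isoperimetric inequality for convex pentagons. -/
theorem volume_pentagon_le (z : Fin 5 → ℂ) (hz : ∀ k, z k ∉ convexHull ℝ (z '' {k}ᶜ))
    (hdisj : ∀ i, Disjoint (segment ℝ (z i) (z (i + 1))) (segment ℝ (z (i + 2)) (z (i + 3)))) :
    volume (convexHull ℝ (range z)) ≤ ENNReal.ofReal (pathLength z ^ 2 / (20 * tan36)) := by
  have hz' : ∀ i j k l : Fin 5, j ≠ i → k ≠ i → l ≠ i → z i ∉ convexHull ℝ {z j, z k, z l} := by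
    intro i j k l hj hk hl hmem
    refine hz i (convexHull_mono ?_ hmem)
    rintro _ (rfl | rfl | rfl)
    exacts [⟨j, hj, rfl⟩, ⟨k, hk, rfl⟩, ⟨l, hl, rfl⟩]
  have pos : ∀ i j k : Fin 5, j ≠ i → j ≠ i + 1 → k ≠ i → k ≠ i + 1 → j ≠ k →
      Disjoint (segment ℝ (z i) (z (i + 1))) (segment ℝ (z j) (z k)) →
      0 < cross (z i) (z (i + 1)) (z j) * cross (z i) (z (i + 1)) (z k) := by
    intro i j k h1 h2 h3 h4 h5 hd
    have h0 : i + 1 ≠ i := (fin_five_ne i).2.1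
    exact cross_mul_pos (hz' _ _ _ _ h0 h1 h3) (hz' _ _ _ _ h0.symm h2 h4)
      (hz' _ _ _ _ h1.symm h2.symm h5.symm) (hz' _ _ _ _ h3.symm h4.symm h5) hd
  have p1 : ∀ i, 0 < cross (z i) (z (i + 1)) (z (i + 2)) * cross (z i) (z (i + 1)) (z (i + 3)) := by
    intro i
    refine pos i (i + 2) (i + 3) ?_ ?_ ?_ ?_ ?_ (hdisj i) <;> revert i <;> decide
  have p2 : ∀ i, 0 < cross (z i) (z (i + 1)) (z (i + 3)) * cross (z i) (z (i + 1)) (z (i + 4)) := by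
    intro i
    refine pos i (i + 3) (i + 4) ?_ ?_ ?_ ?_ ?_ ?_
    on_goal 6 =>
      have := (hdisj (i + 3)).symm
      have e : ∀ i : Fin 5, i + 3 + 2 = i ∧ i + 3 + 3 = i + 1 ∧ i + 3 + 1 = i + 4 := by decide
      rwa [(e i).1, (e i).2.1, (e i).2.2] at this
    all_goals revert i; decide
  -- Both turns are compared with the side of edge i + 1 on which vertex i lies, so consecutive
  -- turns have equal signs.
  have p3 : ∀ i, 0 < cross (z i) (z (i + 1)) (z (i + 2)) *
      cross (z (i + 1)) (z (i + 1 + 1)) (z (i + 1 + 2)) := by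
    intro i
    have e : ∀ i : Fin 5, i + 1 + 1 = i + 2 ∧ i + 1 + 2 = i + 3 ∧ i + 1 + 3 = i + 4 ∧
      i + 1 + 4 = i := by decide
    have q1 := p1 (i + 1)
    have q2 := p2 (i + 1)
    rw [(e i).1, (e i).2.1, (e i).2.2.1] at q1
    rw [(e i).1, (e i).2.2.1, (e i).2.2.2] at q2
    rw [(e i).1, (e i).2.1]
    have cyc : cross (z i) (z (i + 1)) (z (i + 2)) = cross (z (i + 1)) (z (i + 2)) (z i) := by
      simp only [cross]; ring
    rw [cyc]
    have := mul_pos q1 q2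
    nlinarith [sq_nonneg (cross (z (i + 1)) (z (i + 2)) (z (i + 4)))]
  have tri_cases : ∀ i j : Fin 5, j ≠ i → j ≠ i + 1 → j = i + 2 ∨ j = i + 3 ∨ j = i + 4 := by decide
  have trans : ∀ {x y w : ℝ}, 0 < x * y → 0 < y * w → 0 < x * w := by
    intro x y w h1 h2
    have := mul_pos h1 h2
    nlinarith [sq_nonneg y]
  have t0 : 0 < cross (z 0) (z 1) (z 2) * cross (z 0) (z 1) (z 2) :=
    trans (p3 0) (by rw [mul_comm]; exact p3 0)
  have t1 : 0 < cross (z 0) (z 1) (z 2) * cross (z 1) (z 2) (z 3) := p3 0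
  have t2 : 0 < cross (z 0) (z 1) (z 2) * cross (z 2) (z 3) (z 4) := trans t1 (p3 1)
  have t3 : 0 < cross (z 0) (z 1) (z 2) * cross (z 3) (z 4) (z 0) := trans t2 (p3 2)
  have t4 : 0 < cross (z 0) (z 1) (z 2) * cross (z 4) (z 0) (z 1) := trans t3 (p3 3)
  have same : ∀ i, 0 < cross (z 0) (z 1) (z 2) * cross (z i) (z (i + 1)) (z (i + 2)) := by
    intro i
    fin_cases i
    exacts [t0, t1, t2, t3, t4]
  have all : ∀ i j, j ≠ i → j ≠ i + 1 →
      0 < cross (z 0) (z 1) (z 2) * cross (z i) (z (i + 1)) (z j) := by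
    intro i j h1 h2
    rcases tri_cases i j h1 h2 with rfl | rfl | rfl
    · exact same i
    · exact trans (same i) (p1 i)
    · exact trans (trans (same i) (p1 i)) (p2 i)
  rcases lt_or_ge 0 (cross (z 0) (z 1) (z 2)) with hs | hs
  · refine (volume_convex_pentagon z fun i j h1 h2 => ?_).trans
      (ENNReal.ofReal_le_ofReal (shoelace_le z))
    exact (mul_pos_iff_of_pos_left hs).1 (all i j h1 h2)
  -- A clockwise pentagon is traversed backwards.
  · have hlen : pathLength (fun i => z (-i)) = pathLength z := by
      simp only [pathLength]
      rw [← Equiv.sum_comp ((Equiv.neg (Fin 5)).trans (Equiv.addRight (-1 : Fin 5)))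
        fun i => dist (z i) (z (i + 1))]
      refine Finset.sum_congr rfl fun i _ => ?_
      rw [dist_comm]
      simp [add_comm]
    have hrange : range (fun i => z (-i)) = range z := (Equiv.neg (Fin 5)).surjective.range_comp z
    rw [← hrange, ← hlen]
    refine (volume_convex_pentagon _ fun i j h1 h2 => ?_).trans
      (ENNReal.ofReal_le_ofReal (shoelace_le _))
    have e : ∀ i j : Fin 5, j ≠ i → j ≠ i + 1 → -j ≠ -(i + 1) ∧ -j ≠ -(i + 1) + 1 ∧
      -(i + 1) + 1 = -i := by decide
    obtain ⟨e1, e2, e3⟩ := e i j h1 h2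
    have := all (-(i + 1)) (-j) e1 e2
    rw [e3] at this
    have sw : cross (z (-i)) (z (-(i + 1))) (z (-j)) = -cross (z (-(i + 1))) (z (-i)) (z (-j)) := by
      simp only [cross]; ring
    rw [sw]
    by_contra hneg
    nlinarith

/-! ### Pentagons and the convex hull of their vertices -/

/-- A linear functional separating a point of K from C attains its maximum over K at a point outside
C, hence in the interior of K, where a nonzero functional has no maximum. -/
theorem subset_of_frontier_subset {K C : Set ℂ} (hK : IsCompact K) (hC : IsClosed C)
    (hconv : Convex ℝ C) (hne : C.Nonempty) (h : frontier K ⊆ C) : K ⊆ C := by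
  intro x hx
  by_contra hxC
  obtain ⟨f, u, hf, hfx⟩ := geometric_hahn_banach_closed_point hconv hC hxC
  obtain ⟨a, ha⟩ := hne
  obtain ⟨y, hyK, hy⟩ := hK.exists_isMaxOn ⟨x, hx⟩ f.continuous.continuousOn
  have hfy : f x ≤ f y := hy hx
  have hyi : y ∈ interior K := by
    by_contra hyi
    have := hf y (h ⟨subset_closure hyK, hyi⟩)
    linarith
  have hcont : ContinuousAt (fun t : ℝ => y + t • (x - a)) 0 := by fun_prop
  have hnhds : ∀ᶠ t in 𝓝 (0 : ℝ), y + t • (x - a) ∈ interior K :=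
    hcont (by simpa using isOpen_interior.mem_nhds hyi)
  obtain ⟨t, ht, ht0⟩ := ((hnhds.filter_mono nhdsWithin_le_nhds).and
    (self_mem_nhdsWithin (s := Ioi (0 : ℝ)))).exists
  have h1 : f (y + t • (x - a)) ≤ f y := hy (interior_subset ht)
  have h2 := hf a ha
  rw [map_add, map_smul, map_sub, smul_eq_mul] at h1
  have h3 : 0 < t * (f x - f a) := mul_pos ht0 (by linarith)
  linarith

theorem edgeSet_eq_segment {n : ℕ} (P : Polygon ℂ n) (i : Fin n) :
    P.edgeSet ℝ i = segment ℝ (P i) (P (finRotate n i)) := affineSegment_eq_segment _ _ _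

theorem boundary_eq (P : Polygon ℂ 5) :
    P.boundary ℝ = ⋃ i, segment ℝ (P i) (P (i + 1)) := by
  simp only [Polygon.boundary, edgeSet_eq_segment, finRotate_apply]

theorem perimeter_eq_pathLength (P : Polygon ℂ 5) : perimeter P = pathLength P.vertices := by
  simp only [perimeter, pathLength, finRotate_apply]

theorem Pentagon.region_subset_convexHull (P : Pentagon) :
    P.region ⊆ convexHull ℝ (range P.poly.vertices) := by
  refine subset_of_frontier_subset P.isCompact_region ((finite_range _).isClosed_convexHull ℝ)
    (convex_convexHull ℝ _) ((convexHull_nonempty_iff.2 (range_nonempty _))) ?_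
  rw [P.frontier_region, boundary_eq]
  exact iUnion_subset fun i => segment_subset_convexHull (mem_range_self _) (mem_range_self _)

/-- The sinusoid changes sign under a shift by π. After shifting the directions in (−π, 0] by π, the
two pieces both lie in (0, π] and overlap only where the sinusoid vanishes, which is at most one
point. -/
theorem volume_halfPlane_directions {A B : ℝ} (h : A ≠ 0 ∨ B ≠ 0) :
    volume {φ : ℝ | φ ∈ Ioc (-π) π ∧ 0 ≤ A * Real.cos φ + B * Real.sin φ} ≤ ENNReal.ofReal π := by
  set g : ℝ → ℝ := fun φ => A * Real.cos φ + B * Real.sin φ with hg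
  have hgc : Continuous g := by fun_prop
  have hpi := Real.pi_pos
  have hgm : MeasurableSet {φ | 0 ≤ g φ} := (isClosed_le continuous_const hgc).measurableSet
  set E₁ := {φ : ℝ | φ ∈ Ioc 0 π ∧ 0 ≤ g (φ - π)} with hE1
  set E₂ := {φ : ℝ | φ ∈ Ioc 0 π ∧ 0 ≤ g φ} with hE2
  have hshift : ∀ φ, g (φ - π) = -g φ := by
    intro φ
    simp only [hg, Real.cos_sub_pi, Real.sin_sub_pi]
    ring
  have hsub : {φ : ℝ | φ ∈ Ioc (-π) π ∧ 0 ≤ g φ} ⊆ (fun φ => φ + π) ⁻¹' E₁ ∪ E₂ := by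
    rintro φ ⟨⟨h1, h2⟩, h3⟩
    rcases le_or_gt φ 0 with h0 | h0
    · left
      exact ⟨⟨by linarith, by linarith⟩, by simpa using h3⟩
    · exact Or.inr ⟨⟨h0, h2⟩, h3⟩
  have hE2m : MeasurableSet E₂ := measurableSet_Ioc.inter hgm
  have hinter : volume (E₁ ∩ E₂) = 0 := by
    refine Set.Subsingleton.measure_zero ?_ _
    rintro x ⟨⟨hx, hx1⟩, ⟨_, hx2⟩⟩ y ⟨⟨hy, hy1⟩, ⟨_, hy2⟩⟩
    rw [hshift] at hx1 hy1
    have gx : A * Real.cos x + B * Real.sin x = 0 := le_antisymm (by linarith) hx2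
    have gy : A * Real.cos y + B * Real.sin y = 0 := le_antisymm (by linarith) hy2
    have hsin : Real.sin (x - y) = 0 := by
      rw [Real.sin_sub]
      rcases h with h | h
      · apply mul_left_cancel₀ h
        linear_combination Real.sin x * gy - Real.sin y * gx
      · apply mul_left_cancel₀ h
        linear_combination Real.cos y * gx - Real.cos x * gy
    have := (Real.sin_eq_zero_iff_of_lt_of_lt (by linarith [hx.1, hy.2]) (by linarith [hx.2, hy.1])).1
      hsin
    linarith
  calc volume {φ : ℝ | φ ∈ Ioc (-π) π ∧ 0 ≤ g φ}
      ≤ volume ((fun φ => φ + π) ⁻¹' E₁) + volume E₂ :=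
        (measure_mono hsub).trans (measure_union_le _ _)
    _ = volume E₁ + volume E₂ := by rw [measure_preimage_add_right]
    _ = volume (E₁ ∪ E₂) + volume (E₁ ∩ E₂) := (measure_union_add_inter _ hE2m).symm
    _ = volume (E₁ ∪ E₂) := by rw [hinter, add_zero]
    _ ≤ volume (Ioc 0 π) := measure_mono (union_subset (fun _ h => h.1) fun _ h => h.1)
    _ = ENNReal.ofReal π := by rw [Real.volume_Ioc, sub_zero]

/-- A vertex with a reflex angle lies in the convex hull of the other vertices. -/
theorem Pentagon.mem_convexHull_of_pi_lt (P : Pentagon) {k : Fin 5} (h : π < P.interiorAngle k) :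
    P.poly k ∈ convexHull ℝ (P.poly.vertices '' {k}ᶜ) := by
  by_contra hk
  -- Separating the vertex from the others puts the whole region in a half-plane whose bounding line
  -- passes through the vertex, so the angle there is at most π.
  obtain ⟨f, u, hfk, hf⟩ := geometric_hahn_banach_point_closed (convex_convexHull ℝ _)
    (((toFinite {k}ᶜ).image P.poly.vertices).isClosed_convexHull ℝ) hk
  have hother : ∀ j, j ≠ k → f (P.poly k) < f (P.poly j) := fun j hj =>
    hfk.trans (hf _ (subset_convexHull ℝ _ ⟨j, hj, rfl⟩))
  have hregion : ∀ x ∈ P.region, f (P.poly k) ≤ f x := by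
    intro x hx
    refine convexHull_min (t := {x | f (P.poly k) ≤ f x}) ?_ ?_ (P.region_subset_convexHull hx)
    · rintro _ ⟨j, rfl⟩
      rcases eq_or_ne j k with rfl | hj
      · exact le_refl (f (P.poly j))
      · exact (hother j hj).le
    · exact convex_halfSpace_ge f.toLinearMap.isLinear _
  have hf_eq : ∀ w : ℂ, f w = f 1 * w.re + f Complex.I * w.im := by
    intro w
    have : w = w.re • (1 : ℂ) + w.im • Complex.I := by
      simp [Complex.re_add_im]
    conv_lhs => rw [this]
    rw [map_add, map_smul, map_smul, smul_eq_mul, smul_eq_mul]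
    ring
  have hne : f 1 ≠ 0 ∨ f Complex.I ≠ 0 := by
    by_contra! h0
    have := hother (k + 1) (fin_five_ne k).2.1
    rw [hf_eq, hf_eq (P.poly (k + 1)), h0.1, h0.2] at this
    simp at this
  have hle : volume {φ : ℝ | φ ∈ Ioc (-π) π ∧
      ∀ᶠ r : ℝ in 𝓝[>] 0, P.poly k + r * Complex.exp (φ * Complex.I) ∈ P.region}
      ≤ ENNReal.ofReal π := by
    refine (measure_mono ?_).trans (volume_halfPlane_directions hne)
    rintro φ ⟨hφ, hev⟩
    refine ⟨hφ, ?_⟩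
    obtain ⟨r, hr, hr0⟩ := (hev.and (self_mem_nhdsWithin (s := Ioi (0 : ℝ)))).exists
    have h1 := hregion _ hr
    rw [← Complex.real_smul, map_add, map_smul, smul_eq_mul, hf_eq (Complex.exp _),
      Complex.exp_ofReal_mul_I_re, Complex.exp_ofReal_mul_I_im] at h1
    have hr0' : 0 < r := hr0
    by_contra! hneg
    nlinarith
  have := ENNReal.toReal_mono ENNReal.ofReal_ne_top hle
  rw [ENNReal.toReal_ofReal Real.pi_pos.le] at this
  exact absurd h (not_lt.2 this)

/-- Each of the two vertices may use the other in its convex combination, so they are discarded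
together: neither is an extreme point, and the hull is spanned by its extreme points. -/
theorem convexHull_range_eq_of_mem {z : Fin 5 → ℂ} {i j : Fin 5}
    (hi : z i ∈ convexHull ℝ (z '' {i}ᶜ)) (hj : z j ∈ convexHull ℝ (z '' {j}ᶜ))
    (hz : Function.Injective z) :
    convexHull ℝ (range z) ⊆ convexHull ℝ (z '' {i, j}ᶜ) := by
  have hext : ∀ k, z k ∈ convexHull ℝ (z '' {k}ᶜ) →
      z k ∉ (convexHull ℝ (range z)).extremePoints ℝ := by
    intro k hk hke
    rw [(convex_convexHull ℝ _).mem_extremePoints_iff_mem_sdiff_convexHull_sdiff] at hke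
    refine hke.2 (convexHull_mono ?_ hk)
    rintro _ ⟨l, hl, rfl⟩
    exact ⟨subset_convexHull ℝ _ (mem_range_self l), fun h => hl (hz h)⟩
  have hsub : (convexHull ℝ (range z)).extremePoints ℝ ⊆ z '' {i, j}ᶜ := by
    intro x hx
    obtain ⟨k, rfl⟩ := extremePoints_convexHull_subset hx
    refine ⟨k, ?_, rfl⟩
    rintro (rfl | rfl)
    · exact hext _ hi hx
    · exact hext _ hj hx
  rw [← closure_convexHull_extremePoints ((finite_range z).isCompact_convexHull ℝ)
    (convex_convexHull ℝ _)]
  exact closure_minimal (convexHull_mono hsub) (((toFinite _).image z).isClosed_convexHull ℝ)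

theorem pathLength_eq (z : Fin 5 → ℂ) (k : Fin 5) : pathLength z = dist (z k) (z (k + 1)) +
    dist (z (k + 1)) (z (k + 2)) + dist (z (k + 2)) (z (k + 3)) + dist (z (k + 3)) (z (k + 4)) +
    dist (z (k + 4)) (z k) := by
  have e : ∀ k : Fin 5, k + 1 + 1 = k + 2 ∧ k + 2 + 1 = k + 3 ∧ k + 3 + 1 = k + 4 ∧
    k + 4 + 1 = k := by decide
  obtain ⟨e1, e2, e3, e4⟩ := e k
  rw [pathLength, ← Equiv.sum_comp (Equiv.addLeft k), Fin.sum_univ_five]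
  simp only [Equiv.coe_addLeft, add_zero, e1, e2, e3, e4]

/-- If a vertex lies in the convex hull of the others, the area is at most that of a square of the
same perimeter. -/
theorem volume_le_of_mem {z : Fin 5 → ℂ} {k : Fin 5} (hk : z k ∈ convexHull ℝ (z '' {k}ᶜ)) :
    volume (convexHull ℝ (range z)) ≤ ENNReal.ofReal (pathLength z ^ 2 / 16) := by
  have hsub : z '' {k}ᶜ ⊆ {z (k + 1), z (k + 2), z (k + 3), z (k + 4)} := by
    rintro _ ⟨j, hj, rfl⟩
    have e : ∀ k j : Fin 5, j ≠ k → j = k + 1 ∨ j = k + 2 ∨ j = k + 3 ∨ j = k + 4 := by decide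
    rcases e k j hj with rfl | rfl | rfl | rfl <;> simp
  have hhull : convexHull ℝ (range z) ⊆
      convexHull ℝ {z (k + 1), z (k + 2), z (k + 3), z (k + 4)} := by
    refine convexHull_min ?_ (convex_convexHull ℝ _)
    rintro _ ⟨j, rfl⟩
    rcases eq_or_ne j k with rfl | hj
    · exact convexHull_mono hsub hk
    · exact subset_convexHull ℝ _ (hsub ⟨j, hj, rfl⟩)
  refine (measure_mono hhull).trans ((volume_quad_le _ _ _ _).trans (ENNReal.ofReal_le_ofReal ?_))
  rw [pathLength_eq z k]
  gcongr ?_ ^ 2 / 16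
  linarith [dist_triangle (z (k + 4)) (z k) (z (k + 1))]

/-- If two vertices lie in the convex hull of the others, the area is at most that of an equilateral
triangle of the same perimeter. -/
theorem volume_le_of_mem_of_mem {z : Fin 5 → ℂ} (hz : Function.Injective z) {i j : Fin 5}
    (hij : i ≠ j) (hi : z i ∈ convexHull ℝ (z '' {i}ᶜ)) (hj : z j ∈ convexHull ℝ (z '' {j}ᶜ)) :
    volume (convexHull ℝ (range z)) ≤ ENNReal.ofReal (pathLength z ^ 2 / (12 * √3)) := by
  have main : ∀ a b c : Fin 5, ({i, j}ᶜ : Set (Fin 5)) ⊆ {a, b, c} →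
      dist (z a) (z b) + dist (z b) (z c) + dist (z c) (z a) ≤ pathLength z →
      volume (convexHull ℝ (range z)) ≤ ENNReal.ofReal (pathLength z ^ 2 / (12 * √3)) := by
    intro a b c habc hlen
    have hsub : convexHull ℝ (range z) ⊆ convexHull ℝ {z a, z b, z c} := by
      refine (convexHull_range_eq_of_mem hi hj hz).trans (convexHull_mono ?_)
      rintro _ ⟨k, hk, rfl⟩
      rcases habc hk with rfl | rfl | rfl <;> simp
    refine (measure_mono hsub).trans ((volume_triangle_le _ _ _).trans
      (ENNReal.ofReal_le_ofReal ?_))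
    gcongr
  have hlen := pathLength_eq z i
  have e : ∀ i k : Fin 5, k = i ∨ k = i + 1 ∨ k = i + 2 ∨ k = i + 3 ∨ k = i + 4 := by decide
  have t1 := dist_triangle (z (i + 4)) (z i) (z (i + 1))
  have t2 := dist_triangle (z (i + 4)) (z (i + 1)) (z (i + 2))
  have t3 := dist_triangle (z (i + 1)) (z (i + 2)) (z (i + 3))
  have t4 := dist_triangle (z (i + 2)) (z (i + 3)) (z (i + 4))
  have t5 := dist_triangle (z (i + 3)) (z (i + 4)) (z (i + 1))
  rcases e i j with rfl | rfl | rfl | rfl | rfl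
  · exact absurd rfl hij
  · refine main (i + 2) (i + 3) (i + 4) ?_ (by linarith)
    intro k hk
    simp only [mem_compl_iff, mem_insert_iff, mem_singleton_iff, not_or] at hk ⊢
    have := e i k
    tauto
  · refine main (i + 1) (i + 3) (i + 4) ?_ (by linarith)
    intro k hk
    simp only [mem_compl_iff, mem_insert_iff, mem_singleton_iff, not_or] at hk ⊢
    have := e i k
    tauto
  · refine main (i + 1) (i + 2) (i + 4) ?_ (by linarith)
    intro k hk
    simp only [mem_compl_iff, mem_insert_iff, mem_singleton_iff, not_or] at hk ⊢
    have := e i k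
    tauto
  · refine main (i + 1) (i + 2) (i + 3) ?_ (by linarith)
    intro k hk
    simp only [mem_compl_iff, mem_insert_iff, mem_singleton_iff, not_or] at hk ⊢
    have := e i k
    tauto

/-! ### Lower bounds for perimeters -/

theorem Pentagon.le_perimeter_of_volume_le (P : Pentagon) (hP : volume P.region = 1) {c l : ℝ}
    (hc : 0 < c) (hl : l ^ 2 ≤ c)
    (h : volume (convexHull ℝ (range P.poly.vertices)) ≤
      ENNReal.ofReal (pathLength P.poly.vertices ^ 2 / c)) : l ≤ perimeter P.poly := by
  rw [perimeter_eq_pathLength]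
  have h1 : (1 : ℝ≥0∞) ≤ ENNReal.ofReal (pathLength P.poly.vertices ^ 2 / c) := by
    rw [← hP]
    exact (measure_mono P.region_subset_convexHull).trans h
  rw [ENNReal.one_le_ofReal, le_div_iff₀ hc] at h1
  exact le_of_sq_le_sq (by linarith) (Finset.sum_nonneg fun _ _ => dist_nonneg)

theorem Pentagon.four_le_perimeter (P : Pentagon) (hP : volume P.region = 1) {k : Fin 5}
    (hk : P.poly k ∈ convexHull ℝ (P.poly.vertices '' {k}ᶜ)) : 4 ≤ perimeter P.poly :=
  P.le_perimeter_of_volume_le hP (by norm_num) (by norm_num) (volume_le_of_mem hk)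

/-- Either some vertex is in the hull of the others and the square bound applies, or the vertices
are in convex position and the pentagonal bound applies. The constant lies just below 2√(5
tan(π/5)), the perimeter of the regular pentagon. -/
theorem Pentagon.le_perimeter (P : Pentagon) (hP : volume P.region = 1) :
    3.81182 ≤ perimeter P.poly := by
  by_cases h : ∃ k, P.poly k ∈ convexHull ℝ (P.poly.vertices '' {k}ᶜ)
  · obtain ⟨k, hk⟩ := h
    exact le_trans (by norm_num) (P.four_le_perimeter hP hk)
  · push Not at h
    have ht := lt_tan36
    refine P.le_perimeter_of_volume_le hP (by linarith) ?_ (volume_pentagon_le _ h fun i => ?_)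
    · norm_num
      linarith
    · rw [disjoint_left]
      intro p h1 h2
      have e : ∀ i : Fin 5, i ≠ i + 2 ∧ i + 2 + 1 = i + 3 ∧ i ≠ i + 3 ∧ i + 1 ≠ i + 2 ∧
        i + 1 ≠ i + 3 := by decide
      obtain ⟨e1, e2, e3, e4, e5⟩ := e i
      have := P.simple i (i + 2) e1
      simp only [edgeSet_eq_segment, finRotate_apply, e2] at this
      obtain ⟨h3, h4⟩ := this ⟨h1, h2⟩
      have inj := P.vertices_injective
      rcases h3 with h3 | h3 <;> rcases h4 with h4 | h4
      · exact e1 (inj (h3.symm.trans h4))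
      · exact e3 (inj (h3.symm.trans h4))
      · exact e4 (inj (h3.symm.trans h4))
      · exact e5 (inj (h3.symm.trans h4))

theorem Pentagon.IsType1.le_perimeter {P : Pentagon} (h : P.IsType1) (hP : volume P.region = 1) :
    4 ≤ perimeter P.poly := by
  obtain ⟨-, j, hj⟩ := h
  have : j ∈ {k | π < P.interiorAngle k} := hj ▸ mem_singleton j
  exact P.four_le_perimeter hP (P.mem_convexHull_of_pi_lt this)

theorem Pentagon.IsType2.le_perimeter {P : Pentagon} (h : P.IsType2) (hP : volume P.region = 1) :
    4.559 ≤ perimeter P.poly := by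
  obtain ⟨-, i, j, hij, hset, -⟩ := h
  have hi : i ∈ {k | π < P.interiorAngle k} := hset ▸ mem_insert i {j}
  have hj : j ∈ {k | π < P.interiorAngle k} := hset ▸ mem_insert_of_mem i (mem_singleton j)
  refine P.le_perimeter_of_volume_le hP (by positivity) ?_
    (volume_le_of_mem_of_mem P.vertices_injective hij (P.mem_convexHull_of_pi_lt hi)
      (P.mem_convexHull_of_pi_lt hj))
  have : 1.73205 ≤ √3 := Real.le_sqrt_of_sq_le (by norm_num)
  norm_num
  linarith

theorem Pentagon.IsType1.not_isType2 {P : Pentagon} (h : P.IsType1) : ¬ P.IsType2 := by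
  obtain ⟨-, k, hk⟩ := h
  rintro ⟨-, i, j, hij, hset, -⟩
  rw [hk] at hset
  have hi : i ∈ ({k} : Set (Fin 5)) := hset ▸ mem_insert i {j}
  have hj : j ∈ ({k} : Set (Fin 5)) := hset ▸ mem_insert_of_mem i (mem_singleton j)
  exact hij (hi.trans hj.symm)

theorem perimeter_cairo_bounds : 3.8637 < perimeter cairo ∧ perimeter cairo < 3.863705 := by
  rw [perimeter_cairo]
  have h1 : 1.7320508 < √3 := Real.lt_sqrt_of_sq_lt (by norm_num)
  have h2 : √3 < 1.7320509 := (Real.sqrt_lt' (by norm_num)).2 (by norm_num)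
  have h3 : 1.93185 < √(2 + √3) := Real.lt_sqrt_of_sq_lt (by norm_num; linarith)
  have h4 : √(2 + √3) < 1.9318525 := (Real.sqrt_lt' (by norm_num)).2 (by norm_num; linarith)
  constructor <;> linarith

open Classical in
/-- The excess of the perimeter of a unit-area pentagon over that of the Cairo pentagon. -/
theorem Pentagon.le_perimeter_sub (P : Pentagon) (hP : volume P.region = 1) :
    0.051885 * (2.6 * (if P.IsType1 then 1 else 0) + 13.4 * (if P.IsType2 then 1 else 0)
      - (if P.IsEfficient then 1 else 0)) ≤ perimeter P.poly - perimeter cairo := by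
  -- Here 0.051885 = 3.863705 − 3.81182 is the largest possible saving. The other cases need 4 −
  -- 3.863705 ≥ 2.6 · 0.051885 and 4.559 − 3.863705 ≥ 13.4 · 0.051885.
  obtain ⟨hc1, hc2⟩ := perimeter_cairo_bounds
  by_cases h1 : P.IsType1
  · have hp := h1.le_perimeter hP
    have he : ¬ P.IsEfficient := fun h => by linarith [h.2]
    simp only [h1, h1.not_isType2, he, if_true, if_false]
    linarith
  by_cases h2 : P.IsType2
  · have hp := h2.le_perimeter hP
    have he : ¬ P.IsEfficient := fun h => by linarith [h.2]
    simp only [h1, h2, he, if_true, if_false]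
    linarith
  by_cases he : P.IsEfficient
  · have hp := P.le_perimeter hP
    simp only [h1, h2, he, if_true, if_false]
    linarith
  · have : perimeter cairo < perimeter P.poly := not_le.1 fun h => he ⟨hP, h⟩
    simp only [h1, h2, he, if_false]
    linarith

/-! ### Boundaries of pentagons -/

theorem volume_segment_eq_zero (a b : ℂ) : volume (segment ℝ a b) = 0 := by
  have h := volume_triangle a b b
  have hc : cross a b b = 0 := by simp only [cross]; ring
  rw [pair_eq_singleton, convexHull_pair, hc] at h
  simpa using h

theorem Pentagon.volume_boundary (P : Pentagon) : volume (P.poly.boundary ℝ) = 0 := by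
  rw [boundary_eq]
  exact measure_iUnion_null fun i => volume_segment_eq_zero _ _

theorem Pentagon.isClosed_boundary (P : Pentagon) : IsClosed (P.poly.boundary ℝ) := by
  rw [← P.frontier_region]
  exact isClosed_frontier

theorem Pentagon.volume_interior (P : Pentagon) (hP : volume P.region = 1) :
    volume (interior P.region) = 1 := by
  have hf : volume (frontier P.region) = 0 := by
    rw [P.frontier_region]
    exact P.volume_boundary
  rw [measure_interior_of_null_frontier hf, hP]

theorem Pentagon.eq_of_mem_edgeSet (P : Pentagon) {p : ℂ} (hp : ∀ k, p ≠ P.poly k) {i j : Fin 5}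
    (hi : p ∈ P.poly.edgeSet ℝ i) (hj : p ∈ P.poly.edgeSet ℝ j) : i = j := by
  by_contra hij
  rcases (P.simple i j hij ⟨hi, hj⟩).1 with h | h
  · exact hp _ h
  · exact hp _ h

theorem Pentagon.isClosed_edgeSet (P : Pentagon) (i : Fin 5) : IsClosed (P.poly.edgeSet ℝ i) := by
  rw [edgeSet_eq_segment, ← convexHull_pair]
  exact (toFinite _).isClosed_convexHull ℝ

theorem Pentagon.perimeter_le_hausdorffMeasure (P : Pentagon) :
    ENNReal.ofReal (perimeter P.poly) ≤ μH[1] (P.poly.boundary ℝ) := by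
  have : NullSingletonClass (μH[1] : Measure ℂ) := Measure.nullSingletonClass_hausdorff ℂ one_pos
  rw [Polygon.boundary, measure_iUnion₀, tsum_fintype, perimeter,
    ENNReal.ofReal_sum_of_nonneg fun _ _ => dist_nonneg]
  · refine Finset.sum_le_sum fun i _ => ?_
    rw [edgeSet_eq_segment, hausdorffMeasure_segment, edist_dist]
  · intro i j hij
    refine measure_mono_null (P.simple i j hij) ?_
    exact ((toFinite _).inter_of_left _).measure_zero _
  · exact fun i => (P.isClosed_edgeSet i).measurableSet.nullMeasurableSet

theorem Pentagon.isPreconnected_boundary (P : Pentagon) : IsPreconnected (P.poly.boundary ℝ) := by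
  rw [boundary_eq]
  refine IsPreconnected.iUnion_of_reflTransGen
    (fun i => (convex_segment (𝕜 := ℝ) (P.poly i) (P.poly (i + 1))).isPreconnected) fun i j => ?_
  have step : ∀ k l : Fin 5, l = k + 1 → Relation.ReflTransGen
      (fun i j => (segment ℝ (P.poly i) (P.poly (i + 1)) ∩
        segment ℝ (P.poly j) (P.poly (j + 1))).Nonempty) k l := by
    rintro k l rfl
    exact Relation.ReflTransGen.single
      ⟨P.poly (k + 1), right_mem_segment ℝ _ _, left_mem_segment ℝ _ _⟩
  have e : ∀ i j : Fin 5, (i + 2 = i + 1 + 1 ∧ i + 3 = i + 2 + 1 ∧ i + 4 = i + 3 + 1) ∧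
      (j = i ∨ j = i + 1 ∨ j = i + 2 ∨ j = i + 3 ∨ j = i + 4) := by decide
  obtain ⟨⟨e1, e2, e3⟩, h⟩ := e i j
  have s1 := step i (i + 1) rfl
  have s2 := s1.trans (step (i + 1) (i + 2) e1)
  have s3 := s2.trans (step (i + 2) (i + 3) e2)
  have s4 := s3.trans (step (i + 3) (i + 4) e3)
  rcases h with rfl | rfl | rfl | rfl | rfl
  exacts [.refl, s1, s2, s3, s4]

theorem inter_frontier_nonempty {K H : Set ℂ} (hH : IsPreconnected H) (h1 : (H ∩ K).Nonempty)
    (h2 : (H ∩ Kᶜ).Nonempty) : (H ∩ frontier K).Nonempty := by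
  by_contra hne
  have hd : ∀ x ∈ H, x ∉ frontier K := fun x hx hf => hne ⟨x, hx, hf⟩
  obtain ⟨x, hx, hxK⟩ := h1
  obtain ⟨y, hy, hyK⟩ := h2
  have hint : ∀ z ∈ H, z ∈ closure K → z ∈ interior K := fun z hz hc => by
    by_contra hi
    exact hd z hz ⟨hc, hi⟩
  obtain ⟨z, -, hz1, hz2⟩ := hH (interior K) (closure K)ᶜ isOpen_interior
    isClosed_closure.isOpen_compl
    (fun z hz => by
      by_cases hc : z ∈ closure K
      exacts [Or.inl (hint z hz hc), Or.inr hc])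
    ⟨x, hx, hint x hx (subset_closure hxK)⟩ ⟨y, hy, fun hc => hyK (interior_subset (hint y hy hc))⟩
  exact hz2 (subset_closure (interior_subset hz1))

theorem subset_interior_of_disjoint_frontier {K H : Set ℂ} (hH : IsPreconnected H) (ho : IsOpen H)
    (hd : Disjoint H (frontier K)) (hm : (H ∩ K).Nonempty) : H ⊆ interior K := by
  refine interior_maximal (fun x hx => ?_) ho
  by_contra hxK
  obtain ⟨y, hy, hyf⟩ := inter_frontier_nonempty hH hm ⟨x, hx, hxK⟩
  exact disjoint_left.1 hd hy hyf

/-- Near a point in the relative interior of an edge, one of the sides of the edge lies in the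
region. -/
theorem Pentagon.exists_half_ball_subset (P : Pentagon) {p a b : ℂ} {k : Fin 5}
    (hp : ∀ k, p ≠ P.poly k) (hab : P.poly.edgeSet ℝ k = segment ℝ a b) (hpk : p ∈ segment ℝ a b) :
    ∃ r > 0, Metric.ball p r ∩ {x | 0 < cross a b x} ⊆ interior P.region ∨
      Metric.ball p r ∩ {x | 0 < cross b a x} ⊆ interior P.region := by
  have hne : a ≠ b := by
    rintro rfl
    rw [edgeSet_eq_segment, segment_same] at hab
    have h1 : P.poly k ∈ ({a} : Set ℂ) := hab ▸ left_mem_segment ℝ _ _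
    rw [segment_same] at hpk
    exact hp k (hpk.trans h1.symm)
  have hU : IsOpen (⋃ j ∈ {j : Fin 5 | j ≠ k}, P.poly.edgeSet ℝ j)ᶜ :=
    ((toFinite _).isClosed_biUnion fun j _ => P.isClosed_edgeSet j).isOpen_compl
  have hpU : p ∈ (⋃ j ∈ {j : Fin 5 | j ≠ k}, P.poly.edgeSet ℝ j)ᶜ := by
    simp only [mem_compl_iff, mem_iUnion, not_exists]
    intro j hj hpj
    exact hj (P.eq_of_mem_edgeSet hp hpj (hab ▸ hpk))
  obtain ⟨r, hr, hball⟩ := Metric.isOpen_iff.1 hU p hpU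
  refine ⟨r, hr, ?_⟩
  have hswap : ∀ x, cross b a x = -cross a b x := by intro x; simp only [cross]; ring
  -- In this ball the frontier lies on the line ab, so each open half-disk avoids it and is inside
  -- the region as soon as it meets it.
  have hfr : ∀ x ∈ Metric.ball p r, x ∈ frontier P.region → cross a b x = 0 := by
    intro x hx hxf
    rw [P.frontier_region, Polygon.boundary, mem_iUnion] at hxf
    obtain ⟨j, hj⟩ := hxf
    have hjk : j = k := by
      by_contra hjk
      exact hball hx (mem_biUnion hjk hj)
    rw [hjk, hab] at hj
    obtain ⟨s, t, hs, ht, hst, rfl⟩ := hj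
    rw [cross_combo _ _ _ _ hst]
    simp only [cross]
    ring
  have hcont : ∀ a b : ℂ, Continuous (cross a b) := by
    intro a b
    unfold cross
    fun_prop
  have hconv : ∀ a b : ℂ, Convex ℝ {x | 0 < cross a b x} := by
    intro a b x hx y hy s t hs ht hst
    change 0 < cross a b _
    rw [cross_combo _ _ _ _ hst]
    have hx' : 0 < cross a b x := hx
    have hy' : 0 < cross a b y := hy
    rcases hs.eq_or_lt with rfl | hs
    · obtain rfl : t = 1 := by linarith
      linarith
    · have := mul_pos hs hx'
      have := mul_nonneg ht hy'.le
      linarith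
  have key : ∀ a b : ℂ, (∀ x ∈ Metric.ball p r, x ∈ frontier P.region → cross a b x = 0) →
      (∃ x ∈ Metric.ball p r, x ∈ P.region ∧ 0 < cross a b x) →
      Metric.ball p r ∩ {x | 0 < cross a b x} ⊆ interior P.region := by
    rintro a b h ⟨x, hx1, hx2, hx3⟩
    refine subset_interior_of_disjoint_frontier
      ((convex_ball p r).inter (hconv a b)).isPreconnected
      (Metric.isOpen_ball.inter (isOpen_lt continuous_const (hcont a b))) ?_ ⟨x, ⟨hx1, hx3⟩, hx2⟩
    rw [disjoint_left]
    rintro y ⟨hy1, hy2⟩ hy3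
    exact (ne_of_gt hy2) (h y hy1 hy3)
  have hpR : p ∈ closure (interior P.region) := by
    rw [P.closure_interior_region]
    have : p ∈ frontier P.region := by
      rw [P.frontier_region, Polygon.boundary]
      exact mem_iUnion.2 ⟨k, hab ▸ hpk⟩
    exact P.isCompact_region.isClosed.frontier_subset this
  obtain ⟨x, hx1, hx2⟩ := mem_closure_iff.1 hpR _ Metric.isOpen_ball (Metric.mem_ball_self hr)
  obtain ⟨y, hy1, hy2, hy3⟩ : ∃ y ∈ Metric.ball p r, y ∈ P.region ∧ cross a b y ≠ 0 := by
    -- An interior point that happens to lie on the line is pushed off it perpendicularly.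
    rcases ne_or_eq (cross a b x) 0 with h0 | h0
    · exact ⟨x, hx1, interior_subset hx2, h0⟩
    have hnhds : ∀ᶠ t in 𝓝 (0 : ℝ), x + t • (Complex.I * (b - a)) ∈
        Metric.ball p r ∩ interior P.region := by
      have hc : ContinuousAt (fun t : ℝ => x + t • (Complex.I * (b - a))) 0 := by fun_prop
      exact hc ((Metric.isOpen_ball.inter isOpen_interior).mem_nhds (by simpa using ⟨hx1, hx2⟩))
    obtain ⟨t, ht, ht0⟩ := ((hnhds.filter_mono nhdsWithin_le_nhds).and
      (self_mem_nhdsWithin (s := Ioi (0 : ℝ)))).exists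
    refine ⟨_, ht.1, interior_subset ht.2, ?_⟩
    have e : cross a b (x + t • (Complex.I * (b - a))) = cross a b x + t * dist a b ^ 2 := by
      rw [dist_sq_eq]
      simp [cross]
      ring
    rw [e, h0, zero_add]
    have : 0 < dist a b := dist_pos.2 hne
    have ht0' : 0 < t := ht0
    positivity
  rcases lt_or_gt_of_ne hy3 with h | h
  · right
    refine key b a (fun x hx hxf => by rw [hswap, hfr x hx hxf, neg_zero]) ⟨y, hy1, hy2, ?_⟩
    rw [hswap]
    linarith
  · exact Or.inl (key a b hfr ⟨y, hy1, hy2, h⟩)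

theorem half_ball_inter_nonempty {a b p : ℂ} (hab : a ≠ b) (hp : p ∈ segment ℝ a b) {r s : ℝ}
    (hr : 0 < r) (hs : 0 < s) : ((Metric.ball p r ∩ {x | 0 < cross a b x}) ∩
      (Metric.ball p s ∩ {x | 0 < cross a b x})).Nonempty := by
  have hc : ContinuousAt (fun t : ℝ => p + t • (Complex.I * (b - a))) 0 := by fun_prop
  have hnhds : ∀ᶠ t in 𝓝 (0 : ℝ), p + t • (Complex.I * (b - a)) ∈
      Metric.ball p r ∩ Metric.ball p s :=
    hc ((Metric.isOpen_ball.inter Metric.isOpen_ball).mem_nhds (by simpa using ⟨hr, hs⟩))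
  obtain ⟨t, ht, ht0⟩ := ((hnhds.filter_mono nhdsWithin_le_nhds).and
    (self_mem_nhdsWithin (s := Ioi (0 : ℝ)))).exists
  have hpos : 0 < cross a b (p + t • (Complex.I * (b - a))) := by
    have h0 : cross a b p = 0 := by
      obtain ⟨s, t, hs, ht, hst, rfl⟩ := hp
      rw [cross_combo _ _ _ _ hst]
      simp only [cross]
      ring
    have e : cross a b (p + t • (Complex.I * (b - a))) = cross a b p + t * dist a b ^ 2 := by
      rw [dist_sq_eq]
      simp [cross]
      ring
    rw [e, h0, zero_add]
    have : 0 < dist a b := dist_pos.2 hab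
    have ht0' : 0 < t := ht0
    positivity
  exact ⟨_, ⟨ht.1, hpos⟩, ⟨ht.2, hpos⟩⟩

/-! ### Counting boundaries in a tiling -/

variable {ι : Type*}

theorem PentagonTiling.countable (T : PentagonTiling ι) : Countable ι := by
  have h : (univ : Set ι).Countable := by
    refine Set.PairwiseDisjoint.countable_of_isOpen (s := fun i => interior (T.tile i).region)
      (fun i _ j _ hij => T.disjoint_interiors i j hij) (fun i _ => isOpen_interior) fun i _ => ?_
    by_contra hne
    rw [not_nonempty_iff_eq_empty] at hne
    have := (T.tile i).volume_interior (T.unit_area i)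
    rw [hne, measure_empty] at this
    exact zero_ne_one this
  exact countable_univ_iff.1 h

/-- A point that is not a vertex lies on the boundaries of at most two tiles. -/
theorem PentagonTiling.eq_or_eq_of_mem_boundary (T : PentagonTiling ι) {p : ℂ}
    (hp : ∀ i k, p ≠ (T.tile i).poly k) {i j l : ι} (hij : i ≠ j)
    (hi : p ∈ (T.tile i).poly.boundary ℝ) (hj : p ∈ (T.tile j).poly.boundary ℝ)
    (hl : p ∈ (T.tile l).poly.boundary ℝ) : l = i ∨ l = j := by
  by_contra! hne
  obtain ⟨hli, hlj⟩ := hne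
  have reg : ∀ m, p ∈ (T.tile m).poly.boundary ℝ → p ∈ (T.tile m).region := by
    intro m hm
    rw [← (T.tile m).frontier_region] at hm
    exact (T.tile m).isCompact_region.isClosed.frontier_subset hm
  have edge : ∀ m, i ≠ m → p ∈ (T.tile m).poly.boundary ℝ → ∃ k n,
      (T.tile i).poly.edgeSet ℝ k = (T.tile m).poly.edgeSet ℝ n ∧
        p ∈ (T.tile i).poly.edgeSet ℝ k := by
    intro m him hm
    rcases T.edge_to_edge i m him p ⟨reg i hi, reg m hm⟩ with ⟨k, _, hk, _⟩ | h
    · exact absurd hk.symm (hp i k)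
    · exact h
  obtain ⟨k, n, hkn, hpk⟩ := edge j hij hj
  obtain ⟨k', n', hkn', hpk'⟩ := edge l hli.symm hl
  -- Only one edge of tile i contains p, so all three tiles share that edge. Each then contains a
  -- half-disk on one of its two sides, and two of them overlap.
  obtain rfl := (T.tile i).eq_of_mem_edgeSet (hp i) hpk hpk'
  have hseg := edgeSet_eq_segment (T.tile i).poly k
  set a := (T.tile i).poly k with ha
  set b := (T.tile i).poly (finRotate 5 k) with hb
  have hab : a ≠ b := by
    intro h
    have h1 := (T.tile i).vertices_injective h
    rw [finRotate_apply] at h1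
    exact (fin_five_ne k).2.1 h1.symm
  have hps : p ∈ segment ℝ a b := hseg ▸ hpk
  have hps' : p ∈ segment ℝ b a := segment_symm ℝ a b ▸ hps
  have disj : ∀ m m' : ι, m ≠ m' → ∀ A B : Set ℂ, A ⊆ interior (T.tile m).region →
      B ⊆ interior (T.tile m').region → ¬ (A ∩ B).Nonempty := by
    rintro m m' hm A B hA hB ⟨x, hxA, hxB⟩
    exact disjoint_left.1 (T.disjoint_interiors m m' hm) (hA hxA) (hB hxB)
  obtain ⟨r₁, hr₁, h1⟩ := (T.tile i).exists_half_ball_subset (hp i) hseg hps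
  obtain ⟨r₂, hr₂, h2⟩ := (T.tile j).exists_half_ball_subset (hp j) (hkn ▸ hseg) hps
  obtain ⟨r₃, hr₃, h3⟩ := (T.tile l).exists_half_ball_subset (hp l) (hkn' ▸ hseg) hps
  rcases h1 with h1 | h1 <;> rcases h2 with h2 | h2 <;> rcases h3 with h3 | h3
  · exact disj i j hij _ _ h1 h2 (half_ball_inter_nonempty hab hps hr₁ hr₂)
  · exact disj i j hij _ _ h1 h2 (half_ball_inter_nonempty hab hps hr₁ hr₂)
  · exact disj i l hli.symm _ _ h1 h3 (half_ball_inter_nonempty hab hps hr₁ hr₃)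
  · exact disj j l hlj.symm _ _ h2 h3 (half_ball_inter_nonempty hab.symm hps' hr₂ hr₃)
  · exact disj j l hlj.symm _ _ h2 h3 (half_ball_inter_nonempty hab hps hr₂ hr₃)
  · exact disj i l hli.symm _ _ h1 h3 (half_ball_inter_nonempty hab.symm hps' hr₁ hr₃)
  · exact disj i j hij _ _ h1 h2 (half_ball_inter_nonempty hab.symm hps' hr₁ hr₂)
  · exact disj i j hij _ _ h1 h2 (half_ball_inter_nonempty hab.symm hps' hr₁ hr₂)

/-- Inside any measurable set, the boundaries of the tiles cover the skeleton at most twice. -/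
theorem PentagonTiling.tsum_hausdorffMeasure_le (T : PentagonTiling ι) {A : Set ℂ}
    (hA : MeasurableSet A) :
    ∑' i, μH[1] ((T.tile i).poly.boundary ℝ ∩ A) ≤ 2 * μH[1] (T.skeleton ∩ A) := by
  have := T.countable
  have : NullSingletonClass (μH[1] : Measure ℂ) := Measure.nullSingletonClass_hausdorff ℂ one_pos
  have hmeas : ∀ i, MeasurableSet ((T.tile i).poly.boundary ℝ ∩ A) := fun i =>
    (T.tile i).isClosed_boundary.measurableSet.inter hA
  have hskel : MeasurableSet (T.skeleton ∩ A) :=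
    (MeasurableSet.iUnion fun i => (T.tile i).isClosed_boundary.measurableSet).inter hA
  have hV : (⋃ i, range fun k => (T.tile i).poly k).Countable :=
    countable_iUnion fun i => (finite_range _).countable
  calc ∑' i, μH[1] ((T.tile i).poly.boundary ℝ ∩ A)
      = ∑' i, ∫⁻ x, ((T.tile i).poly.boundary ℝ ∩ A).indicator 1 x ∂μH[1] := by
        simp only [lintegral_indicator_one (hmeas _)]
    _ = ∫⁻ x, ∑' i, ((T.tile i).poly.boundary ℝ ∩ A).indicator 1 x ∂μH[1] :=
        (lintegral_tsum fun i => (measurable_one.indicator (hmeas i)).aemeasurable).symm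
    _ ≤ ∫⁻ x, 2 * (T.skeleton ∩ A).indicator 1 x ∂μH[1] := by
        refine lintegral_mono_ae ?_
        -- The vertices form a countable set, which has length zero.
        filter_upwards [hV.ae_notMem μH[1]] with p hp
        have hp' : ∀ i k, p ≠ (T.tile i).poly k := fun i k h =>
          hp (mem_iUnion.2 ⟨i, k, h.symm⟩)
        by_cases hne : ∃ i, p ∈ (T.tile i).poly.boundary ℝ ∩ A
        swap
        · push Not at hne
          have : ∀ i, ((T.tile i).poly.boundary ℝ ∩ A).indicator (1 : ℂ → ℝ≥0∞) p = 0 :=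
            fun i => indicator_of_notMem (hne i) _
          simp [this]
        obtain ⟨i, hi⟩ := hne
        have hin : p ∈ T.skeleton ∩ A := ⟨mem_iUnion.2 ⟨i, hi.1⟩, hi.2⟩
        obtain ⟨j, hj⟩ : ∃ j, ∀ l, p ∈ (T.tile l).poly.boundary ℝ → l = i ∨ l = j := by
          by_cases h : ∃ j, i ≠ j ∧ p ∈ (T.tile j).poly.boundary ℝ
          · obtain ⟨j, hij, hj⟩ := h
            exact ⟨j, fun l hl => T.eq_or_eq_of_mem_boundary hp' hij hi.1 hj hl⟩
          · push Not at h
            refine ⟨i, fun l hl => Or.inl ?_⟩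
            by_contra hli
            exact h l (Ne.symm hli) hl
        classical
        rw [indicator_of_mem hin, tsum_eq_sum (s := {i, j})]
        · refine (Finset.sum_le_card_nsmul _ _ 1 fun l _ => ?_).trans ?_
          · exact indicator_le_self' (fun _ _ => zero_le_one) p
          · rw [nsmul_one, Pi.one_apply, mul_one]
            exact_mod_cast Finset.card_le_two
        · intro l hl
          refine indicator_of_notMem (fun hm => hl ?_) _
          simpa using hj l hm.1
    _ = 2 * μH[1] (T.skeleton ∩ A) := by
        rw [lintegral_const_mul _ (measurable_one.indicator hskel), lintegral_indicator_one hskel]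

/-- The tiles that are not inside the disk of radius `R` but reach to depth `8` in it. -/
def PentagonTiling.deep (T : PentagonTiling ι) (R : ℝ) : Set ι :=
  {i | ¬ (T.tile i).region ⊆ Metric.closedBall 0 R ∧
    ((T.tile i).region ∩ Metric.ball 0 (R - 8)).Nonempty}

/-- The boundary is connected and reaches from below radius R − 8 to beyond R. The norm is
1-Lipschitz and maps the part in the disk onto an interval of length at least 8. -/
theorem PentagonTiling.eight_le_of_mem_deep (T : PentagonTiling ι) {R : ℝ} (hR : 9 ≤ R) {i : ι}
    (hi : i ∈ T.deep R) :
    8 ≤ μH[1] ((T.tile i).poly.boundary ℝ ∩ Metric.closedBall 0 R) := by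
  obtain ⟨h1, x, hx1, hx2⟩ := hi
  set P := T.tile i
  obtain ⟨u, hu1, hu2⟩ : (Metric.ball (0 : ℂ) (R - 8) ∩ frontier P.region).Nonempty := by
    refine inter_frontier_nonempty (convex_ball (0 : ℂ) (R - 8)).isPreconnected ⟨x, hx2, hx1⟩ ?_
    -- Since R − 8 ≥ 1, the smaller disk has area at least π > 1 and does not fit into a tile.
    by_contra hne
    have hsub : Metric.ball (0 : ℂ) (R - 8) ⊆ P.region := by
      intro y hy
      by_contra hyP
      exact hne ⟨y, hy, hyP⟩
    have hvol := measure_mono (μ := volume) hsub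
    rw [T.unit_area i, Complex.volume_ball] at hvol
    have hle : (1 : ℝ≥0∞) ≤ ENNReal.ofReal (R - 8) ^ 2 :=
      one_le_pow₀ (ENNReal.one_le_ofReal.2 (by linarith))
    have hpi : (1 : ℝ≥0∞) < NNReal.pi := by
      rw [← ENNReal.coe_one, ENNReal.coe_lt_coe, ← NNReal.coe_lt_coe]
      have := Real.pi_gt_three
      simp only [NNReal.coe_one, NNReal.coe_real_pi]
      linarith
    have : (NNReal.pi : ℝ≥0∞) ≤ ENNReal.ofReal (R - 8) ^ 2 * NNReal.pi :=
      le_mul_of_one_le_left' hle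
    exact absurd (hpi.trans_le (this.trans hvol)) (lt_irrefl _)
  obtain ⟨v, hv1, hv2⟩ : ∃ v ∈ frontier P.region, R < ‖v‖ := by
    by_contra! hall
    refine h1 (subset_of_frontier_subset P.isCompact_region Metric.isClosed_closedBall
      (convex_closedBall 0 R) ⟨0, by simp; linarith⟩ fun v hv => ?_)
    simpa using hall v hv
  rw [P.frontier_region] at hu2 hv1
  have hu3 : ‖u‖ < R - 8 := by simpa using hu1
  have himg : Icc (R - 8) R ⊆ (fun z : ℂ => ‖z‖) '' (P.poly.boundary ℝ ∩ Metric.closedBall 0 R) := by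
    have hpre : IsPreconnected ((fun z : ℂ => ‖z‖) '' P.poly.boundary ℝ) :=
      P.isPreconnected_boundary.image _ continuous_norm.continuousOn
    intro t ht
    obtain ⟨w, hw, rfl⟩ := hpre.Icc_subset ⟨u, hu2, rfl⟩ ⟨v, hv1, rfl⟩
      (⟨by linarith [ht.1], by linarith [ht.2]⟩ : t ∈ Icc ‖u‖ ‖v‖)
    exact ⟨w, ⟨hw, by simpa using ht.2⟩, rfl⟩
  have hlip : LipschitzWith 1 (fun z : ℂ => ‖z‖) := lipschitzWith_one_norm
  calc (8 : ℝ≥0∞) = volume (Icc (R - 8) R) := by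
        rw [Real.volume_Icc, sub_sub_cancel]; norm_num
    _ ≤ volume ((fun z : ℂ => ‖z‖) '' (P.poly.boundary ℝ ∩ Metric.closedBall 0 R)) :=
        measure_mono himg
    _ = μH[1] ((fun z : ℂ => ‖z‖) '' (P.poly.boundary ℝ ∩ Metric.closedBall 0 R)) := by
        rw [hausdorffMeasure_real]
    _ ≤ _ := by
        simpa using hlip.hausdorffMeasure_image_le zero_le_one
          (P.poly.boundary ℝ ∩ Metric.closedBall 0 R)

theorem PentagonTiling.finite_inside (T : PentagonTiling ι) (R : ℝ) : (T.inside R).Finite := by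
  have h := Measure.finite_const_le_meas_of_disjoint_iUnion (ι := T.inside R) volume (ε := 1) one_pos
    (As := fun i => interior (T.tile i).region) (fun i => isOpen_interior.measurableSet)
    (fun i j hij => T.disjoint_interiors i j fun h => hij (Subtype.ext h)) ?_
  · have huniv : {i : T.inside R | 1 ≤ volume (interior (T.tile i).region)} = univ :=
      eq_univ_of_forall fun i => ((T.tile i).volume_interior (T.unit_area i)).ge
    rw [huniv] at h
    exact finite_coe_iff.1 (finite_univ_iff.1 h)
  · refine ne_top_of_le_ne_top (measure_closedBall_lt_top (x := (0 : ℂ)) (r := R)).ne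
      (measure_mono (iUnion_subset fun i => interior_subset.trans i.2))

theorem PentagonTiling.sum_le (T : PentagonTiling ι) {R X : ℝ} (hR : 9 ≤ R) (hX : 0 ≤ X)
    (h : μH[1] (T.skeleton ∩ Metric.closedBall 0 R) ≤ ENNReal.ofReal X) :
    (T.deep R).Finite ∧ ∑ i ∈ (T.finite_inside R).toFinset, perimeter (T.tile i).poly +
      8 * (T.deep R).ncard ≤ 2 * X := by
  have hsum := (T.tsum_hausdorffMeasure_le (Metric.isClosed_closedBall (x := (0 : ℂ))
    (ε := R)).measurableSet).trans (mul_le_mul_right h 2)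
  have htop : ∑' i, μH[1] ((T.tile i).poly.boundary ℝ ∩ Metric.closedBall 0 R) ≠ ∞ :=
    ne_top_of_le_ne_top (ENNReal.mul_ne_top ENNReal.ofNat_ne_top ENNReal.ofReal_ne_top) hsum
  have hfin : (T.deep R).Finite :=
    (ENNReal.finite_const_le_of_tsum_ne_top htop (ε := 8) (by norm_num)).subset
      fun i hi => T.eight_le_of_mem_deep hR hi
  refine ⟨hfin, ?_⟩
  classical
  have hdisj : Disjoint (T.finite_inside R).toFinset hfin.toFinset := by
    rw [Finset.disjoint_left]
    intro i hi hd
    exact ((hfin.mem_toFinset).1 hd).1 (((T.finite_inside R).mem_toFinset).1 hi)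
  have hle := (ENNReal.sum_le_tsum ((T.finite_inside R).toFinset ∪ hfin.toFinset)).trans hsum
  rw [Finset.sum_union hdisj] at hle
  have hin : ENNReal.ofReal (∑ i ∈ (T.finite_inside R).toFinset, perimeter (T.tile i).poly) ≤
      ∑ i ∈ (T.finite_inside R).toFinset,
        μH[1] ((T.tile i).poly.boundary ℝ ∩ Metric.closedBall 0 R) := by
    rw [ENNReal.ofReal_sum_of_nonneg fun i _ =>
      show 0 ≤ perimeter _ from Finset.sum_nonneg fun _ _ => dist_nonneg]
    refine Finset.sum_le_sum fun i hi => ?_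
    have hi' : (T.tile i).region ⊆ Metric.closedBall 0 R := ((T.finite_inside R).mem_toFinset).1 hi
    rw [inter_eq_left.2]
    · exact (T.tile i).perimeter_le_hausdorffMeasure
    · rw [← (T.tile i).frontier_region]
      exact (T.tile i).isCompact_region.isClosed.frontier_subset.trans hi'
  have hdeep : ENNReal.ofReal (8 * (T.deep R).ncard) ≤ ∑ i ∈ hfin.toFinset,
      μH[1] ((T.tile i).poly.boundary ℝ ∩ Metric.closedBall 0 R) := by
    refine le_trans ?_ (Finset.card_nsmul_le_sum _ _ 8 fun i hi =>
      T.eight_le_of_mem_deep hR ((hfin.mem_toFinset).1 hi))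
    rw [ncard_eq_toFinset_card _ hfin, nsmul_eq_mul, mul_comm,
      ENNReal.ofReal_mul (by positivity), ENNReal.ofReal_natCast]
    norm_num
  have hnn : 0 ≤ ∑ i ∈ (T.finite_inside R).toFinset, perimeter (T.tile i).poly :=
    Finset.sum_nonneg fun i _ => Finset.sum_nonneg fun _ _ => dist_nonneg
  have := (add_le_add hin hdeep).trans hle
  rw [← ENNReal.ofReal_add hnn (by positivity), show (2 : ℝ≥0∞) = ENNReal.ofReal 2 by norm_num,
    ← ENNReal.ofReal_mul (by norm_num)] at this
  exact (ENNReal.ofReal_le_ofReal_iff (by positivity)).1 this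

/-- Each tile that meets the disk of radius R − 8 is either inside the large disk or deep, and has
area 1. -/
theorem PentagonTiling.area_le (T : PentagonTiling ι) {R : ℝ} (hR : 9 ≤ R)
    (hfin : (T.deep R).Finite) :
    π * (R - 8) ^ 2 ≤ (T.inside R).ncard + (T.deep R).ncard := by
  classical
  have hin := T.finite_inside R
  have hcover : Metric.ball (0 : ℂ) (R - 8) ⊆
      ⋃ i ∈ hin.toFinset ∪ hfin.toFinset, (T.tile i).region := by
    intro x hx
    obtain ⟨i, hi⟩ := mem_iUnion.1 (T.cover ▸ mem_univ x : x ∈ ⋃ i, (T.tile i).region)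
    refine mem_biUnion ?_ hi
    simp only [Finset.coe_union, Finite.coe_toFinset, mem_union]
    by_cases h : (T.tile i).region ⊆ Metric.closedBall 0 R
    · exact Or.inl h
    · exact Or.inr ⟨h, x, hi, hx⟩
  have hle := (measure_mono (μ := volume) hcover).trans (measure_biUnion_finset_le _ _)
  simp only [T.unit_area, Finset.sum_const, nsmul_one] at hle
  rw [Complex.volume_ball, ← ENNReal.ofReal_pow (by linarith),
    ← ENNReal.ofReal_coe_nnreal (p := NNReal.pi), NNReal.coe_real_pi,
    ← ENNReal.ofReal_mul (by positivity)] at hle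
  have hcard := Finset.card_union_le hin.toFinset hfin.toFinset
  rw [← ncard_eq_toFinset_card _ hin, ← ncard_eq_toFinset_card _ hfin] at hcard
  have h2 := hle.trans (Nat.cast_le.2 hcard)
  rw [← ENNReal.ofReal_natCast, ENNReal.ofReal_le_ofReal_iff (by positivity)] at h2
  push_cast at h2
  linarith

/-! ### The limit -/

open Classical in
theorem PentagonTiling.ncard_eq_sum (T : PentagonTiling ι) (S : Pentagon → Prop) (R : ℝ) :
    ({i ∈ T.inside R | S (T.tile i)}.ncard : ℝ) =
      ∑ i ∈ (T.finite_inside R).toFinset, if S (T.tile i) then (1 : ℝ) else 0 := by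
  rw [Finset.sum_boole]
  congr 1
  rw [← ncard_coe_finset]
  congr 1
  ext i
  simp

theorem PentagonTiling.ncard_mul_le (T : PentagonTiling ι) (R : ℝ) :
    0.051885 * (2.6 * ({i ∈ T.inside R | (T.tile i).IsType1}.ncard : ℝ)
      + 13.4 * ({i ∈ T.inside R | (T.tile i).IsType2}.ncard : ℝ)
      - ({i ∈ T.inside R | (T.tile i).IsEfficient}.ncard : ℝ)) ≤
    ∑ i ∈ (T.finite_inside R).toFinset, perimeter (T.tile i).poly
      - perimeter cairo * (T.inside R).ncard := by
  classical
  rw [T.ncard_eq_sum, T.ncard_eq_sum, T.ncard_eq_sum, ncard_eq_toFinset_card _ (T.finite_inside R),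
    mul_comm (perimeter cairo), ← nsmul_eq_mul, ← Finset.sum_const, ← Finset.sum_sub_distrib,
    Finset.mul_sum, Finset.mul_sum, ← Finset.sum_add_distrib, ← Finset.sum_sub_distrib,
    Finset.mul_sum]
  exact Finset.sum_le_sum fun i _ => (T.tile i).le_perimeter_sub (T.unit_area i)

theorem PentagonTiling.fraction_nonneg (T : PentagonTiling ι) (S : Pentagon → Prop) (R : ℝ) :
    0 ≤ T.fraction S R := by
  unfold fraction
  positivity

theorem PentagonTiling.fraction_le_one (T : PentagonTiling ι) (S : Pentagon → Prop) (R : ℝ) :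
    T.fraction S R ≤ 1 := by
  refine div_le_one_of_le₀ ?_ (by positivity)
  exact_mod_cast ncard_le_ncard (sep_subset _ _) (T.finite_inside R)

theorem PentagonTiling.eventually_hausdorffMeasure_le (T : PentagonTiling ι)
    (hT : T.perimeterRatio ≤ ENNReal.ofReal (perimeter prismatic / 2)) {ε : ℝ} (hε : 0 < ε) :
    ∀ᶠ R : ℝ in atTop, μH[1] (T.skeleton ∩ Metric.closedBall 0 R) ≤
      ENNReal.ofReal ((perimeter cairo / 2 + ε) * (π * R ^ 2)) := by
  have hc := perimeter_cairo_bounds.1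
  have hlt : T.perimeterRatio < ENNReal.ofReal (perimeter cairo / 2 + ε) := by
    refine hT.trans_lt ?_
    rw [perimeter_prismatic, ← perimeter_cairo]
    exact (ENNReal.ofReal_lt_ofReal_iff (by linarith)).2 (by linarith)
  filter_upwards [eventually_lt_of_limsup_lt hlt, eventually_gt_atTop 0] with R hR hR0
  have hpos : 0 < π * R ^ 2 := by positivity
  rw [ENNReal.ofReal_mul (by linarith)]
  refine (ENNReal.div_le_iff ?_ ENNReal.ofReal_ne_top).1 hR.le
  exact (ENNReal.ofReal_pos.2 hpos).ne'

theorem PentagonTiling.eventually_ge (T : PentagonTiling ι)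
    (hT : T.perimeterRatio ≤ ENNReal.ofReal (perimeter prismatic / 2)) {η : ℝ} (hη : 0 < η) :
    ∀ᶠ R : ℝ in atTop, -η ≤ T.fraction Pentagon.IsEfficient R
      - 2.6 * T.fraction Pentagon.IsType1 R - 13.4 * T.fraction Pentagon.IsType2 R := by
  obtain ⟨hc1, hc2⟩ := perimeter_cairo_bounds
  -- The bound 0.05 keeps c/2 + ε below 2. The other bound and the lower bound on R each let one of
  -- the two error terms use half of 0.051885 · η · πR²/4.
  set ε := min 0.05 (0.051885 * η / 16) with hεdef
  have hε : 0 < ε := by positivity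
  have hε1 : ε ≤ 0.05 := min_le_left _ _
  have hε2 : ε ≤ 0.051885 * η / 16 := min_le_right _ _
  filter_upwards [T.eventually_hausdorffMeasure_le hT hε, eventually_ge_atTop 64,
    eventually_ge_atTop (128 * 4 / (0.051885 * η))] with R hR hR64 hRη
  have hpi := Real.pi_pos
  obtain ⟨hfin, hsum⟩ := T.sum_le (by linarith) (by positivity) hR
  have harea := T.area_le (by linarith) hfin
  have hcount := T.ncard_mul_le R
  rw [div_le_iff₀ (by positivity)] at hRη
  have hS : 0 ≤ ∑ i ∈ (T.finite_inside R).toFinset, perimeter (T.tile i).poly :=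
    Finset.sum_nonneg fun i _ => Finset.sum_nonneg fun _ _ => dist_nonneg
  unfold fraction
  set c := perimeter cairo
  set N : ℝ := ((T.inside R).ncard : ℝ)
  set D : ℝ := ((T.deep R).ncard : ℝ)
  set S := ∑ i ∈ (T.finite_inside R).toFinset, perimeter (T.tile i).poly
  set n₀ : ℝ := ({i ∈ T.inside R | (T.tile i).IsEfficient}.ncard : ℝ)
  set n₁ : ℝ := ({i ∈ T.inside R | (T.tile i).IsType1}.ncard : ℝ)
  set n₂ : ℝ := ({i ∈ T.inside R | (T.tile i).IsType2}.ncard : ℝ)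
  have hD0 : 0 ≤ D := Nat.cast_nonneg _
  have hQ : 0 < π * R ^ 2 := by positivity
  -- The length bound gives 8D ≤ 4πR², which leaves at least πR²/4 tiles inside.
  have hD : D ≤ π * R ^ 2 / 2 := by
    have : (c / 2 + ε) * (π * R ^ 2) ≤ 2 * (π * R ^ 2) := by
      gcongr
      linarith
    linarith
  have hR2 : π * R * 64 ≤ π * R ^ 2 := by
    have : π * R * 64 ≤ π * R * R := by gcongr
    linarith
  have hN : π * R ^ 2 / 4 ≤ N := by
    have e : π * (R - 8) ^ 2 = π * R ^ 2 - 16 * (π * R) + 64 * π := by ring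
    linarith
  have hN0 : 0 < N := by linarith
  have hexcess : S - c * N ≤ 2 * ε * (π * R ^ 2) + 64 * (π * R) := by
    have h1 : c * (π * (R - 8) ^ 2) ≤ c * (N + D) := by gcongr
    have h2 : c * (π * (R - 8) ^ 2) = c * (π * R ^ 2) - 16 * c * (π * R) + 64 * c * π := by ring
    -- The choice of depth 8 > c matters here: the boundary length of the deep tiles pays for the
    -- area that they cover.
    have h3 : c * D ≤ 8 * D := by gcongr; linarith
    have h4 : 16 * c * (π * R) ≤ 64 * (π * R) := by gcongr; linarith
    have h5 : 0 ≤ 64 * c * π := by positivity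
    linarith
  have hbound : 2 * ε * (π * R ^ 2) + 64 * (π * R) ≤ 0.051885 * η * N := by
    have h1 : 0.051885 * η * (π * R ^ 2 / 4) ≤ 0.051885 * η * N := by gcongr
    have h2 : 2 * ε * (π * R ^ 2) ≤ 2 * (0.051885 * η / 16) * (π * R ^ 2) := by gcongr
    have h3 : 128 * 4 * (π * R) ≤ R * (0.051885 * η) * (π * R) := by gcongr
    have h4 : R * (0.051885 * η) * (π * R) = 0.051885 * η * (π * R ^ 2) := by ring
    linarith
  have e : n₀ / N - 2.6 * (n₁ / N) - 13.4 * (n₂ / N) = (n₀ - 2.6 * n₁ - 13.4 * n₂) / N := by ring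
  rw [e, le_div_iff₀ hN0]
  linarith

end PentagonTilings

end

theorem proposition5p3 {ι : Type*} (T : PentagonTilings.PentagonTiling ι)
    (hT : T.perimeterRatio ≤
      ENNReal.ofReal (PentagonTilings.perimeter PentagonTilings.prismatic / 2)) :
    0 ≤ liminf (fun R : ℝ =>
      T.fraction PentagonTilings.Pentagon.IsEfficient R
        - 2.6 * T.fraction PentagonTilings.Pentagon.IsType1 R
        - 13.4 * T.fraction PentagonTilings.Pentagon.IsType2 R) atTop := by
  refine le_of_forall_pos_le_add fun η hη => ?_
  -- A real `liminf` is meaningful only for a function that does not tend to infinity; here the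
  -- fractions lie in [0, 1].
  have hcob : IsCoboundedUnder (· ≥ ·) atTop (fun R : ℝ =>
      T.fraction PentagonTilings.Pentagon.IsEfficient R
        - 2.6 * T.fraction PentagonTilings.Pentagon.IsType1 R
        - 13.4 * T.fraction PentagonTilings.Pentagon.IsType2 R) := by
    refine isCoboundedUnder_ge_of_le atTop (x := 1) fun R => ?_
    linarith [T.fraction_le_one PentagonTilings.Pentagon.IsEfficient R,
      T.fraction_nonneg PentagonTilings.Pentagon.IsType1 R,
      T.fraction_nonneg PentagonTilings.Pentagon.IsType2 R]
  have := le_liminf_of_le hcob (T.eventually_ge hT hη)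
  linarith
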